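/- Let $\mathcal H$ be a complex Hilbert space, $T\in\mathcal B(\mathcal H)$ a self-adjoint operator and $\lambda\in\mathbb R\setminus\{-1,0\}$. Let $\mathcal N(\cdot)$ denote the null space, and let $\mathcal H_0$ be the orthogonal complement of the sum of $\mathcal N(T)$, $\mathcal N(T-I)$, $\mathcal N(T-\lambda I)$ and $\mathcal N(T-(1+\lambda)I)$; it reduces $T$, and we put $T_0=T|_{\mathcal H_0}$. Suppose that there are a complex Hilbert space $\mathcal K$, a positive operator $B\in\mathcal B(\mathcal K)$ with $\frac{|1-|\lambda||}{2}I<B<\frac{1+|\lambda|}{2}I$ (where $A<C$ means that $C-A$ is positive and injective) and a unitary operator from $\mathcal K\oplus\mathcal K$ onto $\mathcal H_0$, by which we identify $\mathcal H_0$ with $\mathcal K\oplus\mathcal K$, such that $T_0-\frac{1+\lambda}{2}I=B\oplus(-B)$. Let $\mathcal T_\lambda$ be the set of all pairs $(P,Q)$ of orthogonal projections on $\mathcal H$ with $T=\lambda P+Q$, and let $W^*(\mathcal T_\lambda)$ be the (unital) von Neumann algebra on $\mathcal H$ generated by all the projections $P$ and $Q$ that occur in pairs in $\mathcal T_\lambda$.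 Write $'$ for the commutant, $W^*(B)$ for the von Neumann algebra on $\mathcal K$ generated by $B$, $M_2(\{B\}')$ for the algebra of $2\times2$ operator matrices on $\mathcal K\oplus\mathcal K$ with entries in $\{B\}'$, and $W^*(B)^{(2)}=\{R\oplus R: R\in W^*(B)\}$. If $\lambda=1$, then with respect to $\mathcal H=\mathcal N(T)\oplus\mathcal N(T-I)\oplus\mathcal N(T-2I)\oplus\mathcal H_0$, $$W^*(\mathcal T_\lambda)=\mathbb CI\oplus\mathcal B(\mathcal N(T-I))\oplus\mathbb CI\oplus M_2(\{B\}'),$$ $$W^*(\mathcal T_\lambda)'=\mathcal B(\mathcal N(T))\oplus\mathbb CI\oplus\mathcal B(\mathcal N(T-2I))\oplus W^*(B)^{(2)}.$$ If $\lambda\ne1$, then with respect to $\mathcal H=\mathcal N(T)\oplus\mathcal N(T-I)\oplus\mathcal N(T-\lambda I)\oplus\mathcal N(T-(1+\lambda)I)\oplus\mathcal H_0$, $$W^*(\mathcal T_\lambda)=\mathbb CI\oplus\mathbb CI\oplus\mathbb CI\oplus\mathbb CI\oplus M_2(\{B\}'),$$ $$W^*(\mathcal T_\lambda)'=\mathcal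 B(\mathcal N(T))\oplus\mathcal B(\mathcal N(T-I))\oplus\mathcal B(\mathcal N(T-\lambda I))\oplus\mathcal B(\mathcal N(T-(1+\lambda)I))\oplus W^*(B)^{(2)}.$$ -/

import Mathlib

noncomputable section

/-! ## Von Neumann algebras -/

section VonNeumann

variable {H : Type*} [NormedAddCommGroup H] [InnerProductSpace ℂ H] [CompleteSpace H]

/-- `W*(S)`: the von Neumann algebra generated by a set `S` of bounded operators on `H`, i.e. the
intersection of all von Neumann algebras on `H` (unital, as always in Mathlib) that contain `S`. -/
def generatedVNA (S : Set (H →L[ℂ] H)) : VonNeumannAlgebra H where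
  toStarSubalgebra := sInf {A | ∃ M : VonNeumannAlgebra H,
    S ⊆ (M : Set (H →L[ℂ] H)) ∧ M.toStarSubalgebra = A}
  centralizer_centralizer' := by
    refine Set.Subset.antisymm ?_ Set.subset_centralizer_centralizer
    intro a ha
    refine StarSubalgebra.mem_sInf.2 ?_
    rintro _ ⟨M, hM, rfl⟩
    have hsub : ((sInf {A | ∃ M : VonNeumannAlgebra H,
        S ⊆ (M : Set (H →L[ℂ] H)) ∧ M.toStarSubalgebra = A} : StarSubalgebra ℂ (H →L[ℂ] H)) :
        Set (H →L[ℂ] H)) ⊆ (M : Set (H →L[ℂ] H)) :=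
      fun x hx => StarSubalgebra.mem_sInf.1 hx _ ⟨M, hM, rfl⟩
    have h := Set.centralizer_subset (Set.centralizer_subset hsub) ha
    rw [VonNeumannAlgebra.centralizer_centralizer] at h
    exact h

end VonNeumann

/-! ## Order, operator matrices, unitary equivalence, direct sums -/

section Operators

variable {H : Type*} [NormedAddCommGroup H] [InnerProductSpace ℂ H]
  {K : Type*} [NormedAddCommGroup K] [InnerProductSpace ℂ K]

/-- The strict order `A < B` on operators: `B - A` is positive and injective. -/
def StrictOpLT (A B : H →L[ℂ] H) : Prop :=
  (B - A).IsPositive ∧ Function.Injective (B - A)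

/-- The Hilbert space `K ⊕ K`. -/
abbrev TwoFold (K : Type*) : Type _ := PiLp 2 (fun _ : Fin 2 => K)

/-- The operator on `K ⊕ K` given by the operator matrix `(R i j)`:
the `i`-th component of its value at `z` is `∑ j, R i j (z j)`. -/
def opMatrix (R : Matrix (Fin 2) (Fin 2) (K →L[ℂ] K)) : TwoFold K →L[ℂ] TwoFold K :=
  ((PiLp.continuousLinearEquiv 2 ℂ (fun _ : Fin 2 => K)).symm :
      (Fin 2 → K) →L[ℂ] TwoFold K) ∘L
    ContinuousLinearMap.pi fun i =>
      ∑ j, R i j ∘L PiLp.proj 2 (𝕜 := ℂ) (fun _ : Fin 2 => K) j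

/-- `M₂(𝓡)`: the operator matrices on `K ⊕ K` with entries in `𝓡`. -/
def matrixAlg (𝓡 : Set (K →L[ℂ] K)) : Set (TwoFold K →L[ℂ] TwoFold K) :=
  {A | ∃ R : Matrix (Fin 2) (Fin 2) (K →L[ℂ] K), (∀ i j, R i j ∈ 𝓡) ∧ A = opMatrix R}

/-- The 2-fold inflation `𝓡⁽²⁾ = {R ⊕ R : R ∈ 𝓡}`, acting on `K ⊕ K`. -/
def inflation (𝓡 : Set (K →L[ℂ] K)) : Set (TwoFold K →L[ℂ] TwoFold K) :=
  {A | ∃ R ∈ 𝓡, A = opMatrix !![R, 0; 0, R]}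

/-- The operator `V A V*` on `F`, for a unitary operator `V : E → F` and an operator `A` on `E`. -/
def unitaryConj {E F : Type*} [NormedAddCommGroup E] [InnerProductSpace ℂ E]
    [NormedAddCommGroup F] [InnerProductSpace ℂ F] (V : E ≃ₗᵢ[ℂ] F) (A : E →L[ℂ] E) :
    F →L[ℂ] F :=
  V.toContinuousLinearEquiv.conjContinuousAlgEquiv A

/-- A subspace of `H` together with a set of operators on it, to be used as one summand of
a direct sum of operator algebras. -/
structure Summand (H : Type*) [NormedAddCommGroup H] [InnerProductSpace ℂ H] where
  /-- the subspace -/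
  space : Submodule ℂ H
  /-- the operators on the subspace -/
  ops : Set (space →L[ℂ] space)

/-- The summand `ℂI` acting on `M`. -/
def scalarOps (M : Submodule ℂ H) : Summand H :=
  ⟨M, {a | ∃ c : ℂ, a = c • (1 : M →L[ℂ] M)}⟩

/-- The summand `𝓑(M)` acting on `M`. -/
def allOps (M : Submodule ℂ H) : Summand H :=
  ⟨M, Set.univ⟩

/-- The direct sum of operator algebras `𝒜₁ ⊕ ⋯ ⊕ 𝒜ₙ` with respect to an orthogonal decomposition
`H = M₁ ⊕ ⋯ ⊕ Mₙ`: the operators `A` on `H` whose restriction to each `Mᵢ` is an operator `aᵢ` on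
`Mᵢ` that belongs to `𝒜ᵢ`. -/
def directSumOps (L : List (Summand H)) : Set (H →L[ℂ] H) :=
  {A | ∀ s ∈ L, ∃ a ∈ s.ops, ∀ x : s.space, A (x : H) = (a x : H)}

end Operators

/-! ## Pencils of pairs of projections -/

section Pencil

variable {H : Type*} [NormedAddCommGroup H] [InnerProductSpace ℂ H]

/-- The null space `N(T - cI)`. -/
def nullSpace (T : H →L[ℂ] H) (c : ℝ) : Submodule ℂ H :=
  LinearMap.ker (T - (c : ℂ) • (1 : H →L[ℂ] H) : H →L[ℂ] H).toLinearMap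

/-- `H₀`: the orthogonal complement of
`N(T) ⊕ N(T - I) ⊕ N(T - lam I) ⊕ N(T - (1 + lam) I)`. -/
def genericSpace (T : H →L[ℂ] H) (lam : ℝ) : Submodule ℂ H :=
  (nullSpace T 0 ⊔ nullSpace T 1 ⊔ nullSpace T lam ⊔ nullSpace T (1 + lam))ᗮ

theorem map_nullSpace (T : H →L[ℂ] H) (c : ℝ) (x : H) (hx : x ∈ nullSpace T c) :
    T x = (c : ℂ) • x := by
  simpa [nullSpace, sub_eq_zero] using hx

variable [CompleteSpace H]

theorem map_mem_genericSpace {T : H →L[ℂ] H} (hT : IsSelfAdjoint T) (lam : ℝ) :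
    ∀ x ∈ genericSpace T lam, T x ∈ genericSpace T lam := by
  intro x hx
  have hs : ∀ u v : H, inner ℂ (T u) v = inner ℂ u (T v) := hT.isSymmetric
  simp only [genericSpace, ← Submodule.inf_orthogonal, Submodule.mem_inf,
    Submodule.mem_orthogonal] at hx ⊢
  have key : ∀ c : ℝ, (∀ u ∈ nullSpace T c, inner ℂ u x = 0) →
      ∀ u ∈ nullSpace T c, inner ℂ u (T x) = 0 := by
    intro c h u hu
    rw [← hs, map_nullSpace T c u hu, inner_smul_left, h u hu, mul_zero]
  obtain ⟨⟨⟨h1, h2⟩, h3⟩, h4⟩ := hx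
  exact ⟨⟨⟨key _ h1, key _ h2⟩, key _ h3⟩, key _ h4⟩

/-- The generic part `T₀ = T|_{H₀}` of the self-adjoint operator `T` with respect to `lam`. -/
def genericPart (T : H →L[ℂ] H) (hT : IsSelfAdjoint T) (lam : ℝ) :
    genericSpace T lam →L[ℂ] genericSpace T lam :=
  T.restrict (map_mem_genericSpace hT lam)

/-- `𝒯_lam`: all pairs `(P, Q)` of orthogonal projections on `H` with `T = lam P + Q`. -/
def pencilPairs (T : H →L[ℂ] H) (lam : ℝ) : Set ((H →L[ℂ] H) × (H →L[ℂ] H)) :=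
  {p | IsStarProjection p.1 ∧ IsStarProjection p.2 ∧ T = (lam : ℂ) • p.1 + p.2}

/-- `W*(𝒯_lam)`: the von Neumann algebra generated by the projections that occur in the pairs
belonging to `𝒯_lam`. -/
def pencilVNA (T : H →L[ℂ] H) (lam : ℝ) : VonNeumannAlgebra H :=
  generatedVNA {A | ∃ p ∈ pencilPairs T lam, A = p.1 ∨ A = p.2}

variable {K : Type*} [NormedAddCommGroup K] [InnerProductSpace ℂ K]

/-- `M₂({B}′)` acting on `H₀`, where `H₀` is identified with `K ⊕ K` by `V`. -/
def commutantSummand (T : H →L[ℂ] H) (lam : ℝ) (V : TwoFold K ≃ₗᵢ[ℂ] genericSpace T lam)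
    (B : K →L[ℂ] K) : Summand H :=
  ⟨genericSpace T lam, unitaryConj V '' matrixAlg (Set.centralizer {B})⟩

/-- `W*(B)⁽²⁾` acting on `H₀`, where `H₀` is identified with `K ⊕ K` by `V`. -/
def inflationSummand [CompleteSpace K] (T : H →L[ℂ] H) (lam : ℝ)
    (V : TwoFold K ≃ₗᵢ[ℂ] genericSpace T lam) (B : K →L[ℂ] K) : Summand H :=
  ⟨genericSpace T lam, unitaryConj V '' inflation (generatedVNA {B} : Set (K →L[ℂ] K))⟩

end Pencil

end

noncomputable section

/-! ### Generated von Neumann algebras as double commutants -/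

section GeneratedVNA

variable {H : Type*} [NormedAddCommGroup H] [InnerProductSpace ℂ H] [CompleteSpace H]

/-! The commutant is computed first. The algebra is then its commutant, because the generating set
of projections is self-adjoint (`coe_generatedVNA`), and the commutant of a direct sum is taken
summand by summand (`centralizer_familyOps`).

Localisation: an operator commuting with some pair commutes with `T = lam P + Q`, so it preserves
the null spaces and, by adjoints, `H₀`. The projections of the pairs preserve these subspaces too,
and pairs on the summands glue independently to pairs on `H`. Hence the commutant is the direct sum
of the commutants belonging to the parts of `T` (`centralizer_pencilOps_eq_familyOps`).

Null spaces: on `N(T - (lam e + f))` with `e, f ∈ {0, 1}` the projections must act as the scalars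
`e` and `f`, so every operator commutes with them. The exception is the eigenvalue `1` for `lam =
1`, where `1 = 1 + 0 = 0 + 1`: the pairs there are `(P, 1 - P)` with `P` arbitrary, and only scalars
commute with all of them.

Generic part: put `C = B ⊕ (-B)` and `S = 2P - 1`. Then `2Q - 1 = 2C - lam S`, and its square is `1`
exactly when `lam (CS + SC) = 2C² + (lam² - 1)/2`. Solutions are `S = [[s, gu], [(gu)*, -s]]` with
`lam B s = B² + (lam² - 1)/4`, `g = (1 - s²)^(1/2)` and `u` any unitary in `{B}′`; the bounds on `B`
make `1 - s²` positive and injective. An operator commuting with `C` is diagonal with entries `a, d`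
in `{B}′`. The pair with `u = 1` forces `a = d`, and general `u` forces `a` to commute with all
unitaries of `{B}′`, so `a ∈ W*(B)`. Conversely, `C² = B² ⊕ B²` commutes with all `P` and `Q`
(`commute_sq_of_mem_pencilOps`), so their entries lie in `{B}′` and `W*(B)⁽²⁾` commutes with them;
no classification of all pairs is needed (`centralizer_pencilOps_model`). -/

theorem subset_generatedVNA (S : Set (H →L[ℂ] H)) : S ⊆ (generatedVNA S : Set (H →L[ℂ] H)) := by
  intro x hx
  refine StarSubalgebra.mem_sInf.2 ?_
  rintro _ ⟨M, hM, rfl⟩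
  exact hM hx

theorem generatedVNA_subset {S : Set (H →L[ℂ] H)} (M : VonNeumannAlgebra H)
    (h : S ⊆ (M : Set (H →L[ℂ] H))) : (generatedVNA S : Set (H →L[ℂ] H)) ⊆ M :=
  fun _ hx => StarSubalgebra.mem_sInf.1 hx _ ⟨M, h, rfl⟩

/-- The double commutant of a self-adjoint set of operators. -/
def doubleCommutantVNA (S : Set (H →L[ℂ] H)) : VonNeumannAlgebra H where
  toStarSubalgebra := StarSubalgebra.centralizer ℂ (StarSubalgebra.centralizer ℂ S)
  centralizer_centralizer' := by simp

theorem coe_doubleCommutantVNA {S : Set (H →L[ℂ] H)} (hS : ∀ a ∈ S, star a ∈ S) :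
    (doubleCommutantVNA S : Set (H →L[ℂ] H)) = S.centralizer.centralizer := by
  have h : star S = S := Set.ext fun x => ⟨fun hx => by simpa using hS _ hx, fun hx => hS _ hx⟩
  change (StarSubalgebra.centralizer ℂ (StarSubalgebra.centralizer ℂ S : Set (H →L[ℂ] H)) :
    Set (H →L[ℂ] H)) = _
  rw [StarSubalgebra.coe_centralizer_centralizer, h, Set.union_self]

/-- Von Neumann's double commutant description of the algebra generated by a self-adjoint set. -/
theorem coe_generatedVNA {S : Set (H →L[ℂ] H)} (hS : ∀ a ∈ S, star a ∈ S) :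
    (generatedVNA S : Set (H →L[ℂ] H)) = S.centralizer.centralizer := by
  refine Set.Subset.antisymm ?_ ?_
  · rw [← coe_doubleCommutantVNA hS]
    refine generatedVNA_subset _ ?_
    rw [coe_doubleCommutantVNA hS]
    exact Set.subset_centralizer_centralizer
  · rw [← VonNeumannAlgebra.centralizer_centralizer (generatedVNA S)]
    exact Set.centralizer_subset (Set.centralizer_subset (subset_generatedVNA S))

theorem coe_commutant_generatedVNA {S : Set (H →L[ℂ] H)} (hS : ∀ a ∈ S, star a ∈ S) :
    ((generatedVNA S).commutant : Set (H →L[ℂ] H)) = S.centralizer := by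
  rw [VonNeumannAlgebra.coe_commutant, coe_generatedVNA hS, Set.centralizer_centralizer_centralizer]

end GeneratedVNA

/-! ### Algebra of operator matrices on `K ⊕ K` -/

section OperatorMatrix

variable {K : Type*} [NormedAddCommGroup K] [InnerProductSpace ℂ K]

@[simp]
theorem opMatrix_apply (R : Matrix (Fin 2) (Fin 2) (K →L[ℂ] K)) (z : TwoFold K) (i : Fin 2) :
    opMatrix R z i = ∑ j, R i j (z j) := by
  simp [opMatrix]

theorem opMatrix_mul (R S : Matrix (Fin 2) (Fin 2) (K →L[ℂ] K)) :
    opMatrix (R * S) = opMatrix R * opMatrix S := by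
  ext z i
  simp [Matrix.mul_apply]
  abel

theorem opMatrix_add (R S : Matrix (Fin 2) (Fin 2) (K →L[ℂ] K)) :
    opMatrix (R + S) = opMatrix R + opMatrix S := by
  ext z i
  simp
  abel

theorem opMatrix_smul (c : ℂ) (R : Matrix (Fin 2) (Fin 2) (K →L[ℂ] K)) :
    opMatrix (c • R) = c • opMatrix R := by
  ext z i
  simp

theorem opMatrix_one : opMatrix (1 : Matrix (Fin 2) (Fin 2) (K →L[ℂ] K)) = 1 := by
  ext z i
  fin_cases i <;> simp [Matrix.one_apply]

theorem opMatrix_injective :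
    Function.Injective (opMatrix : Matrix (Fin 2) (Fin 2) (K →L[ℂ] K) → _) := by
  intro R S h
  ext i j x
  have := congrArg (fun A : TwoFold K →L[ℂ] TwoFold K => A (WithLp.toLp 2 (Pi.single j x)) i) h
  fin_cases j <;> simpa using this

theorem opMatrix_surjective :
    Function.Surjective (opMatrix : Matrix (Fin 2) (Fin 2) (K →L[ℂ] K) → _) := by
  intro A
  refine ⟨Matrix.of fun i j => PiLp.proj 2 (𝕜 := ℂ) (fun _ : Fin 2 => K) i ∘L A ∘L
    ((PiLp.continuousLinearEquiv 2 ℂ (fun _ : Fin 2 => K)).symm :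
      (Fin 2 → K) →L[ℂ] TwoFold K) ∘L ContinuousLinearMap.single ℂ (fun _ : Fin 2 => K) j, ?_⟩
  ext z i
  have hz : z = WithLp.toLp 2 (Pi.single 0 (z 0)) + WithLp.toLp 2 (Pi.single 1 (z 1)) := by
    ext i
    fin_cases i <;> simp
  conv_rhs => rw [hz, map_add]
  simp

variable [CompleteSpace K]

theorem star_opMatrix (R : Matrix (Fin 2) (Fin 2) (K →L[ℂ] K)) :
    star (opMatrix R) = opMatrix (star R) := by
  rw [ContinuousLinearMap.star_eq_adjoint, eq_comm, ContinuousLinearMap.eq_adjoint_iff]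
  intro x y
  simp [PiLp.inner_apply, Matrix.star_apply, ContinuousLinearMap.star_eq_adjoint,
    ContinuousLinearMap.adjoint_inner_left, inner_add_left, inner_add_right]
  abel

end OperatorMatrix

/-! ### Operators built from `B`: the diagonal `s`, the modulus `g`, unitaries of `{B}′` -/

section Lyapunov

variable {K : Type*} [NormedAddCommGroup K] [InnerProductSpace ℂ K]

theorem mul_left_cancel_of_injective {g a b : K →L[ℂ] K} (hg : Function.Injective g)
    (h : g * a = g * b) : a = b := by
  ext x
  exact hg (congrArg (fun A : K →L[ℂ] K => A x) h)

/-- Adding a nonnegative scalar preserves the injectivity of a positive operator. -/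
theorem injective_add_smul_one {D : K →L[ℂ] K} (hD : D.IsPositive) (hinj : Function.Injective D)
    {c : ℝ} (hc : 0 ≤ c) : Function.Injective (D + (c : ℂ) • (1 : K →L[ℂ] K)) := by
  rcases hc.eq_or_lt with rfl | hc
  · simpa using hinj
  rw [injective_iff_map_eq_zero]
  intro x hx
  have h1 := hD.re_inner_nonneg_left x
  have h2 : inner ℂ (D x) x + c * inner ℂ x x = 0 := by
    have := congrArg (fun y => inner ℂ y x) hx
    simpa [inner_add_left, inner_smul_left] using this
  have h3 := congrArg Complex.re h2
  rw [Complex.add_re, Complex.re_ofReal_mul, Complex.zero_re] at h3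
  have h4 : (inner ℂ x x : ℂ).re = ‖x‖ ^ 2 := by
    simpa using inner_self_eq_norm_sq (𝕜 := ℂ) x
  rw [h4] at h3
  have h5 : 0 ≤ (inner ℂ (D x) x : ℂ).re := h1
  have h6 : ‖x‖ ^ 2 = 0 := by
    by_contra h
    have : 0 < ‖x‖ ^ 2 := lt_of_le_of_ne (by positivity) (Ne.symm h)
    nlinarith [mul_pos hc this]
  simpa using h6

variable [CompleteSpace K]

/-- An operator commuting with the square of a positive operator commutes with the operator. -/
theorem commute_of_commute_mul_self {B a : K →L[ℂ] K} (hB : 0 ≤ B) (h : Commute (B * B) a) :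
    Commute B a := by
  rw [← CFC.sqrt_mul_self B hB, CFC.sqrt_eq_cfc]
  exact h.cfc_nnreal _

/-- Positivity of a self-adjoint operator can be tested on the dense range of an injective
self-adjoint operator. -/
theorem nonneg_of_conj_nonneg {B A : K →L[ℂ] K} (hB : IsSelfAdjoint B)
    (hinj : Function.Injective B) (hA : IsSelfAdjoint A) (h : 0 ≤ B * A * B) : 0 ≤ A := by
  rw [ContinuousLinearMap.nonneg_iff_isPositive] at h ⊢
  have hs : ∀ u v : K, inner ℂ (B u) v = inner ℂ u (B v) := hB.isSymmetric
  have hdense : DenseRange B := by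
    have : (LinearMap.range B.toLinearMap)ᗮ = ⊥ := by
      rw [Submodule.eq_bot_iff]
      intro x hx
      have h1 : inner ℂ (B (B x)) x = 0 := Submodule.inner_right_of_mem_orthogonal
        (K := LinearMap.range B.toLinearMap) ⟨B x, rfl⟩ hx
      apply hinj
      rwa [map_zero, ← inner_self_eq_zero (𝕜 := ℂ), ← hs]
    have h2 := (Submodule.topologicalClosure_eq_top_iff (K := LinearMap.range B.toLinearMap)).2 this
    rw [← Submodule.dense_iff_topologicalClosure_eq_top] at h2
    exact h2
  refine ⟨hA.isSymmetric, fun x => ?_⟩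
  refine hdense.induction_on (p := fun x => 0 ≤ A.reApplyInnerSelf x) x ?_ ?_
  · exact isClosed_le continuous_const A.reApplyInnerSelf_continuous
  · intro y
    have := h.2 y
    simpa [ContinuousLinearMap.reApplyInnerSelf, hs] using this

/-- The solution `s = lam⁻¹ (B + (lam² - 1) / 4 B⁻¹)` of `lam B s = B² + (lam² - 1) / 4`. -/
theorem exists_lyapunov_solution {lam : ℝ} (hlam0 : lam ≠ 0) {B : K →L[ℂ] K}
    (hB : IsSelfAdjoint B)
    (hBlower : StrictOpLT (((abs (1 - |lam|) / 2 : ℝ) : ℂ) • (1 : K →L[ℂ] K)) B) :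
    ∃ s : K →L[ℂ] K, IsSelfAdjoint s ∧ (∀ x, Commute B x → Commute s x) ∧
      (lam : ℂ) • (B * s) = B * B + (((lam ^ 2 - 1) / 4 : ℝ) : ℂ) • (1 : K →L[ℂ] K) := by
  have hl : (lam : ℂ) ≠ 0 := by exact_mod_cast hlam0
  have key : ∃ E : K →L[ℂ] K, IsSelfAdjoint E ∧ (∀ x, Commute B x → Commute E x) ∧
      B * E = (((lam ^ 2 - 1) / 4 : ℝ) : ℂ) • (1 : K →L[ℂ] K) := by
    -- `E` plays the role of `(lam² - 1)/4 B⁻¹`. If `|lam| = 1`, then `B` may fail to be invertible,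
    -- but the coefficient vanishes; otherwise `B` is bounded below by a positive scalar.
    by_cases h1 : |lam| = 1
    · refine ⟨0, .zero _, fun x _ => Commute.zero_left x, ?_⟩
      have : lam ^ 2 = 1 := by rw [← sq_abs, h1, one_pow]
      simp [this]
    · set c : ℝ := abs (1 - |lam|) / 2 with hc
      have hcpos : 0 < c := by
        have : 0 < abs (1 - |lam|) := abs_pos.2 (sub_ne_zero.2 (Ne.symm h1))
        positivity
      have hcc : (c : ℂ) ≠ 0 := by exact_mod_cast hcpos.ne'
      have hle : ((c : ℂ) • (1 : K →L[ℂ] K)) ≤ B := (ContinuousLinearMap.le_def _ _).2 hBlower.1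
      have hsp : IsStrictlyPositive ((c : ℂ) • (1 : K →L[ℂ] K)) := by
        refine ⟨?_, ?_⟩
        · rw [ContinuousLinearMap.nonneg_iff_isPositive]
          exact ContinuousLinearMap.isPositive_one.smul_of_nonneg (by exact_mod_cast hcpos.le)
        · exact ⟨⟨(c : ℂ) • 1, (c : ℂ)⁻¹ • 1, by
            rw [smul_mul_smul_comm, mul_inv_cancel₀ hcc, one_smul, mul_one], by
            rw [smul_mul_smul_comm, inv_mul_cancel₀ hcc, one_smul, mul_one]⟩, rfl⟩
      obtain ⟨u, hu⟩ := CStarAlgebra.isUnit_of_le _ hle hsp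
      have hBi : B * (↑u⁻¹ : K →L[ℂ] K) = 1 := by rw [← hu, Units.mul_inv]
      have hiB : (↑u⁻¹ : K →L[ℂ] K) * B = 1 := by rw [← hu, Units.inv_mul]
      have hsa : star (↑u⁻¹ : K →L[ℂ] K) = ↑u⁻¹ := by
        have h2 : star (↑u⁻¹ : K →L[ℂ] K) * B = 1 := by
          have := congrArg star hBi
          rwa [star_mul, hB.star_eq, star_one] at this
        calc star (↑u⁻¹ : K →L[ℂ] K) = star (↑u⁻¹ : K →L[ℂ] K) * (B * ↑u⁻¹) := by
              rw [hBi, mul_one]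
          _ = ↑u⁻¹ := by rw [← mul_assoc, h2, one_mul]
      refine ⟨(((lam ^ 2 - 1) / 4 : ℝ) : ℂ) • (↑u⁻¹ : K →L[ℂ] K), ?_, ?_, ?_⟩
      · rw [IsSelfAdjoint, star_smul, hsa, RCLike.star_def, Complex.conj_ofReal]
      · intro x hx
        rw [← hu] at hx
        exact (hx.units_inv_left).smul_left _
      · rw [mul_smul_comm, hBi]
  obtain ⟨E, hE, hEc, hBE⟩ := key
  refine ⟨((lam⁻¹ : ℝ) : ℂ) • (B + E), ?_, ?_, ?_⟩
  · rw [IsSelfAdjoint, star_smul, star_add, hE.star_eq, hB.star_eq, RCLike.star_def,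
      Complex.conj_ofReal]
  · intro x hx
    exact (hx.add_left (hEc x hx)).smul_left _
  · rw [mul_smul_comm, smul_smul, mul_add, hBE, Complex.ofReal_inv, mul_inv_cancel₀ hl, one_smul]

/-- By the equation for `s`, `lam² B (1 - s²) B = lam² B² - (B² + (lam² - 1)/4)²`, a difference of
squares that splits into four commuting linear factors in `B`. The bounds on `B` make each of them
positive and injective. Then `B` is cancelled on both sides, without being inverted. -/
theorem nonneg_and_injective_one_sub_mul_self {lam : ℝ} (hlam0 : lam ≠ 0) {B s : K →L[ℂ] K}
    (hB : IsSelfAdjoint B)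
    (hBlower : StrictOpLT (((abs (1 - |lam|) / 2 : ℝ) : ℂ) • (1 : K →L[ℂ] K)) B)
    (hBupper : StrictOpLT B ((((1 + |lam|) / 2 : ℝ) : ℂ) • (1 : K →L[ℂ] K)))
    (hs : IsSelfAdjoint s) (hBs : Commute B s)
    (h : (lam : ℂ) • (B * s) = B * B + (((lam ^ 2 - 1) / 4 : ℝ) : ℂ) • (1 : K →L[ℂ] K)) :
    0 ≤ 1 - s * s ∧ Function.Injective (1 - s * s : K →L[ℂ] K) := by
  obtain ⟨hDpos, hDinj⟩ := hBlower
  obtain ⟨hUpos, hUinj⟩ := hBupper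
  set l := |lam| with hl
  set c : ℝ := abs (1 - l) / 2 with hc
  set D := B - (c : ℂ) • (1 : K →L[ℂ] K) with hD
  set U := (((1 + l) / 2 : ℝ) : ℂ) • (1 : K →L[ℂ] K) - B with hU
  have hlpos : 0 < l := abs_pos.2 hlam0
  have hlsq : l ^ 2 = lam ^ 2 := sq_abs lam
  -- Since `c = |1 - l|/2`, the shifts `±(1 - l)/2` are both at least `-c`; this is what the lower
  -- bound on `B` is for.
  have hshift : ∀ d : ℝ, 0 ≤ c + d → 0 ≤ B + (d : ℂ) • (1 : K →L[ℂ] K) ∧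
      Function.Injective (B + (d : ℂ) • (1 : K →L[ℂ] K)) := by
    intro d hd
    have e : B + (d : ℂ) • (1 : K →L[ℂ] K) = D + ((c + d : ℝ) : ℂ) • (1 : K →L[ℂ] K) := by
      rw [hD, Complex.ofReal_add]
      module
    rw [e, ContinuousLinearMap.nonneg_iff_isPositive]
    exact ⟨hDpos.add (ContinuousLinearMap.isPositive_one.smul_of_nonneg (by exact_mod_cast hd)),
      injective_add_smul_one hDpos hDinj hd⟩
  have hc0 : 0 ≤ c := by positivity
  obtain ⟨h1, h1i⟩ := hshift ((l - 1) / 2) (by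
    have := neg_abs_le (l - 1); rw [abs_sub_comm] at this; linarith)
  obtain ⟨h2, h2i⟩ := hshift ((1 - l) / 2) (by have := neg_abs_le (1 - l); linarith)
  obtain ⟨h3, h3i⟩ := hshift ((1 + l) / 2) (by linarith)
  have hBinj : Function.Injective B := by simpa using (hshift 0 (by linarith)).2
  set F1 := B + (((l - 1) / 2 : ℝ) : ℂ) • (1 : K →L[ℂ] K)
  set F2 := B + (((1 - l) / 2 : ℝ) : ℂ) • (1 : K →L[ℂ] K)
  set F3 := B + (((1 + l) / 2 : ℝ) : ℂ) • (1 : K →L[ℂ] K)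
  have hcB : ∀ d : ℂ, ∀ X : K →L[ℂ] K, Commute B X → Commute (B + d • (1 : K →L[ℂ] K)) X :=
    fun d X hX => hX.add_left ((Commute.one_left X).smul_left d)
  have c1 : Commute B F1 := (hcB _ _ (Commute.refl B)).symm
  have c2 : Commute B F2 := (hcB _ _ (Commute.refl B)).symm
  have c3 : Commute B F3 := (hcB _ _ (Commute.refl B)).symm
  have hprod : 0 ≤ U * (F1 * (F2 * F3)) := by
    have hU0 : 0 ≤ U := (ContinuousLinearMap.nonneg_iff_isPositive _).2 hUpos
    have h23 : 0 ≤ F2 * F3 := Commute.mul_nonneg h2 h3 (hcB _ _ c3)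
    have h123 : 0 ≤ F1 * (F2 * F3) := Commute.mul_nonneg h1 h23 (hcB _ _ (c2.mul_right c3))
    refine Commute.mul_nonneg hU0 h123 ?_
    exact ((Commute.one_left _).smul_left _).sub_left (c1.mul_right (c2.mul_right c3))
  have hid : ((lam ^ 2 : ℝ) : ℂ) • (B * (1 - s * s) * B) = U * (F1 * (F2 * F3)) := by
    have e1 : ((lam ^ 2 : ℝ) : ℂ) • (B * (1 - s * s) * B) =
        ((lam ^ 2 : ℝ) : ℂ) • (B * B) - ((lam : ℂ) • (B * s)) * ((lam : ℂ) • (B * s)) := by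
      have : B * (s * s) * B = (B * s) * (B * s) := by
        rw [← mul_assoc, mul_assoc (B * s), hBs.symm.eq]
      rw [mul_sub, sub_mul, this, mul_one, smul_sub, smul_mul_assoc, mul_smul_comm, smul_smul]
      push_cast
      ring_nf
    rw [e1, h, ← hlsq]
    simp only [U, F1, F2, F3, mul_add, add_mul, sub_mul, smul_mul_assoc, mul_smul_comm,
      one_mul, mul_one, smul_add, smul_smul]
    push_cast
    simp only [mul_assoc]
    module
  have hBB : 0 ≤ B * (1 - s * s) * B := by
    have e : B * (1 - s * s) * B = (((lam ^ 2)⁻¹ : ℝ) : ℂ) • (U * (F1 * (F2 * F3))) := by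
      rw [← hid, smul_smul, ← Complex.ofReal_mul, inv_mul_cancel₀ (pow_ne_zero 2 hlam0),
        Complex.ofReal_one, one_smul]
    rw [e, ContinuousLinearMap.nonneg_iff_isPositive]
    refine ((ContinuousLinearMap.nonneg_iff_isPositive _).1 hprod).smul_of_nonneg ?_
    have : 0 ≤ (lam ^ 2)⁻¹ := by positivity
    exact_mod_cast this
  have hsa : IsSelfAdjoint (1 - s * s) := by
    rw [IsSelfAdjoint, star_sub, star_mul, hs.star_eq, star_one]
  refine ⟨nonneg_of_conj_nonneg hB hBinj hsa hBB, ?_⟩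
  have hcomm : Commute (1 - s * s) B :=
    (Commute.one_left B).sub_left (hBs.symm.mul_left hBs.symm)
  have hinj : Function.Injective (U * (F1 * (F2 * F3))) :=
    hUinj.comp (h1i.comp (h2i.comp h3i))
  rw [injective_iff_map_eq_zero]
  intro x hx
  apply hinj
  rw [map_zero, ← hid, mul_assoc, hcomm.eq]
  simp [hx]

/-- The ingredients of the pairs of projections: `s` is the diagonal of the symmetry `2P - 1`, and
`g = (1 - s²)^(1/2)` is the modulus of its off-diagonal entry. -/
theorem exists_diagonal_and_modulus {lam : ℝ} (hlam0 : lam ≠ 0) {B : K →L[ℂ] K}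
    (hB : IsSelfAdjoint B)
    (hBlower : StrictOpLT (((abs (1 - |lam|) / 2 : ℝ) : ℂ) • (1 : K →L[ℂ] K)) B)
    (hBupper : StrictOpLT B ((((1 + |lam|) / 2 : ℝ) : ℂ) • (1 : K →L[ℂ] K))) :
    ∃ s g : K →L[ℂ] K, IsSelfAdjoint s ∧ IsSelfAdjoint g ∧ Function.Injective g ∧
      (∀ x, Commute B x → Commute s x) ∧ (∀ x, Commute B x → Commute g x) ∧
      g * g = 1 - s * s ∧
      (lam : ℂ) • (B * s) = B * B + (((lam ^ 2 - 1) / 4 : ℝ) : ℂ) • (1 : K →L[ℂ] K) := by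
  obtain ⟨s, hs, hsc, h⟩ := exists_lyapunov_solution hlam0 hB hBlower
  obtain ⟨hpos, hinj⟩ := nonneg_and_injective_one_sub_mul_self hlam0 hB hBlower hBupper hs
    (hsc B (Commute.refl B)).symm h
  refine ⟨s, CFC.sqrt (1 - s * s), hs, (CFC.sqrt_nonneg _).isSelfAdjoint, ?_, hsc, ?_,
    CFC.sqrt_mul_sqrt_self _ hpos, h⟩
  · rw [← CFC.sqrt_mul_sqrt_self _ hpos] at hinj
    exact Function.Injective.of_comp (f := (CFC.sqrt (1 - s * s) : K →L[ℂ] K)) hinj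
  · intro x hx
    rw [CFC.sqrt_eq_cfc]
    exact ((Commute.one_left x).sub_left ((hsc x hx).mul_left (hsc x hx))).cfc_nnreal _

/-- An operator commuting with all unitaries of the commutant of a self-adjoint operator `B`
belongs to the double commutant of `B`. -/
theorem mem_double_commutant_of_commute_unitary {B a : K →L[ℂ] K} (hB : IsSelfAdjoint B)
    (h : ∀ u ∈ unitary (K →L[ℂ] K), Commute B u → Commute a u) :
    a ∈ (generatedVNA {B} : Set (K →L[ℂ] K)) := by
  have hstar : ∀ x ∈ ({B} : Set (K →L[ℂ] K)), star x ∈ ({B} : Set (K →L[ℂ] K)) := by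
    simp [hB.star_eq]
  -- A self-adjoint contraction is the mean of the unitary `x + i (1 - x²)^(1/2)` and its adjoint,
  -- both of which lie in `{B}′` when `x` does.
  have hsmall : ∀ x : K →L[ℂ] K, IsSelfAdjoint x → ‖x‖ ≤ 1 → Commute B x → Commute a x := by
    intro x hx hn hBx
    have hsq : Commute B (CFC.sqrt (1 - x ^ 2)) := by
      rw [CFC.sqrt_eq_cfc]
      exact (((Commute.one_left B).sub_left (hBx.symm.pow_left 2)).cfc_nnreal _).symm
    have h1 := h _ (hx.self_add_I_smul_cfcSqrt_sub_sq_mem_unitary x hn)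
      (hBx.add_right (hsq.smul_right _))
    have h2 := h _ (Unitary.star_mem (hx.self_add_I_smul_cfcSqrt_sub_sq_mem_unitary x hn)) (by
      have := (hBx.add_right (hsq.smul_right Complex.I)).star_star
      rwa [hB.star_eq] at this)
    have h3 := (h1.add_right h2).smul_right (2⁻¹ : ℂ)
    have hsqrt : star (CFC.sqrt (1 - x ^ 2)) = CFC.sqrt (1 - x ^ 2) :=
      (CFC.sqrt_nonneg (1 - x ^ 2)).isSelfAdjoint.star_eq
    have e : (2⁻¹ : ℂ) • (x + Complex.I • CFC.sqrt (1 - x ^ 2) +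
        star (x + Complex.I • CFC.sqrt (1 - x ^ 2))) = x := by
      rw [star_add, star_smul, hx.star_eq, hsqrt,
        RCLike.star_def, Complex.conj_I]
      module
    rwa [e] at h3
  have hsa : ∀ x : K →L[ℂ] K, IsSelfAdjoint x → Commute B x → Commute a x := by
    intro x hx hBx
    by_cases h0 : x = 0
    · rw [h0]; exact Commute.zero_right a
    have hn : (‖x‖ : ℂ) ≠ 0 := by exact_mod_cast norm_ne_zero_iff.2 h0
    have h1 := (hsmall ((‖x‖⁻¹ : ℝ) • x) ((IsSelfAdjoint.all (‖x‖⁻¹ : ℝ)).smul hx) (by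
      rw [norm_smul, norm_inv, norm_norm, inv_mul_cancel₀ (norm_ne_zero_iff.2 h0)])
      (hBx.smul_right _)).smul_right (‖x‖ : ℝ)
    rwa [smul_smul, mul_inv_cancel₀ (norm_ne_zero_iff.2 h0), one_smul] at h1
  rw [coe_generatedVNA hstar]
  intro x hx
  have hBx : Commute B x := hx B rfl
  have hBsx : Commute B (star x) := by
    have := hBx.star_star
    rwa [hB.star_eq] at this
  -- Real and imaginary parts reduce a general element of `{B}′` to the self-adjoint case.
  have h1 := hsa (x + star x) (IsSelfAdjoint.add_star_self x) (hBx.add_right hBsx)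
  have h2 := hsa (Complex.I • (x - star x)) (by
    rw [IsSelfAdjoint, star_smul, star_sub, star_star, RCLike.star_def, Complex.conj_I]
    module) ((hBx.sub_right hBsx).smul_right _)
  have h3 := (h1.sub_right (h2.smul_right Complex.I)).smul_right (2⁻¹ : ℂ)
  have e : (2⁻¹ : ℂ) • (x + star x - Complex.I • Complex.I • (x - star x)) = x := by
    rw [smul_smul, Complex.I_mul_I]
    module
  rw [e] at h3
  exact h3.symm.eq

end Lyapunov

/-! ### Commutation relations common to all pairs -/

section PencilOps

variable {H : Type*} [NormedAddCommGroup H] [InnerProductSpace ℂ H] [CompleteSpace H]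

/-- The projections that occur in the pairs belonging to `𝒯_lam`. -/
def pencilOps (T : H →L[ℂ] H) (lam : ℝ) : Set (H →L[ℂ] H) :=
  {A | ∃ p ∈ pencilPairs T lam, A = p.1 ∨ A = p.2}

theorem isStarProjection_of_mem_pencilOps {T : H →L[ℂ] H} {lam : ℝ} {A : H →L[ℂ] H}
    (hA : A ∈ pencilOps T lam) : IsStarProjection A := by
  obtain ⟨p, hp, rfl | rfl⟩ := hA
  exacts [hp.1, hp.2.1]

theorem star_mem_pencilOps {T : H →L[ℂ] H} {lam : ℝ} :
    ∀ A ∈ pencilOps T lam, star A ∈ pencilOps T lam := by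
  intro A hA
  rwa [(isStarProjection_of_mem_pencilOps hA).isSelfAdjoint.star_eq]

theorem commute_of_mem_centralizer_pencilOps {T : H →L[ℂ] H} {lam : ℝ}
    (hne : (pencilPairs T lam).Nonempty) {A : H →L[ℂ] H}
    (hA : A ∈ (pencilOps T lam).centralizer) : Commute T A := by
  obtain ⟨p, hp⟩ := hne
  rw [hp.2.2]
  have h1 : Commute p.1 A := hA _ ⟨p, hp, Or.inl rfl⟩
  have h2 : Commute p.2 A := hA _ ⟨p, hp, Or.inr rfl⟩
  exact (h1.smul_left _).add_left h2

/-- For projections `P`, `Q` and `T = lam P + Q`, the square of `T - (1 + lam) / 2` commutes with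
both `P` and `Q`. -/
theorem commute_sq_of_mem_pencilOps {T : H →L[ℂ] H} {lam : ℝ} {A : H →L[ℂ] H}
    (hA : A ∈ pencilOps T lam) :
    Commute ((T - (((1 + lam) / 2 : ℝ) : ℂ) • 1) * (T - (((1 + lam) / 2 : ℝ) : ℂ) • 1)) A := by
  obtain ⟨⟨P, Q⟩, ⟨hP, hQ, hT⟩, hA⟩ := hA
  dsimp only at hP hQ hT hA
  have hPP : P * P = P := hP.isIdempotentElem
  have hQQ : Q * Q = Q := hQ.isIdempotentElem
  have hPP' : ∀ X, P * (P * X) = P * X := fun X => by rw [← mul_assoc, hPP]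
  have hQQ' : ∀ X, Q * (Q * X) = Q * X := fun X => by rw [← mul_assoc, hQQ]
  subst hT
  -- With `p = P - 1/2` and `q = Q - 1/2` the square is `(lam p + q)² = (lam² + 1)/4 + lam (pq +
  -- qp)`, and `pq + qp` commutes with `p` and `q` because `p² = q² = 1/4`.
  rcases hA with rfl | rfl <;> rw [commute_iff_eq] <;>
  · simp only [mul_add, add_mul, mul_sub, sub_mul, smul_mul_assoc, mul_smul_comm, mul_assoc,
      mul_one, one_mul, smul_add, smul_sub, smul_smul, hPP, hQQ, hPP', hQQ']
    push_cast
    module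

end PencilOps

/-! ### The generic part on `K ⊕ K` -/

section Model

variable {K : Type*} [NormedAddCommGroup K] [InnerProductSpace ℂ K]

theorem opMatrix_fin_two_mul (a b c d a' b' c' d' : K →L[ℂ] K) :
    opMatrix !![a, b; c, d] * opMatrix !![a', b'; c', d'] =
      opMatrix !![a * a' + b * c', a * b' + b * d'; c * a' + d * c', c * b' + d * d'] := by
  rw [← opMatrix_mul, Matrix.mul_fin_two]

theorem opMatrix_fin_two_smul (r : ℂ) (a b c d : K →L[ℂ] K) :
    r • opMatrix !![a, b; c, d] = opMatrix !![r • a, r • b; r • c, r • d] := by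
  simp [← opMatrix_smul]

theorem opMatrix_fin_two_add (a b c d a' b' c' d' : K →L[ℂ] K) :
    opMatrix !![a, b; c, d] + opMatrix !![a', b'; c', d'] =
      opMatrix !![a + a', b + b'; c + c', d + d'] := by
  simp [← opMatrix_add]

theorem opMatrix_one_fin_two : opMatrix !![1, 0; 0, 1] = (1 : TwoFold K →L[ℂ] TwoFold K) := by
  rw [← Matrix.one_fin_two, opMatrix_one]

theorem exists_opMatrix_fin_two (A : TwoFold K →L[ℂ] TwoFold K) :
    ∃ a b c d : K →L[ℂ] K, A = opMatrix !![a, b; c, d] := by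
  obtain ⟨R, rfl⟩ := opMatrix_surjective A
  exact ⟨R 0 0, R 0 1, R 1 0, R 1 1, by rw [← Matrix.eta_fin_two R]⟩

theorem opMatrix_fin_two_inj {a b c d a' b' c' d' : K →L[ℂ] K} :
    opMatrix !![a, b; c, d] = opMatrix !![a', b'; c', d'] ↔
      a = a' ∧ b = b' ∧ c = c' ∧ d = d' := by
  refine ⟨fun h => ?_, by rintro ⟨rfl, rfl, rfl, rfl⟩; rfl⟩
  have h := opMatrix_injective h
  exact ⟨congrFun (congrFun h 0) 0, congrFun (congrFun h 0) 1, congrFun (congrFun h 1) 0,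
    congrFun (congrFun h 1) 1⟩

theorem commute_opMatrix_diagonal_iff {R a b c d : K →L[ℂ] K} :
    Commute (opMatrix !![R, 0; 0, R]) (opMatrix !![a, b; c, d]) ↔
      Commute R a ∧ Commute R b ∧ Commute R c ∧ Commute R d := by
  rw [commute_iff_eq, opMatrix_fin_two_mul, opMatrix_fin_two_mul, opMatrix_fin_two_inj]
  simp [commute_iff_eq]

theorem mem_matrixAlg_iff {𝓡 : Set (K →L[ℂ] K)} {a b c d : K →L[ℂ] K} :
    opMatrix !![a, b; c, d] ∈ matrixAlg 𝓡 ↔ a ∈ 𝓡 ∧ b ∈ 𝓡 ∧ c ∈ 𝓡 ∧ d ∈ 𝓡 := by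
  constructor
  · rintro ⟨R, hR, h⟩
    have h := opMatrix_injective h
    subst h
    exact ⟨hR 0 0, hR 0 1, hR 1 0, hR 1 1⟩
  · rintro ⟨h1, h2, h3, h4⟩
    refine ⟨_, fun i j => ?_, rfl⟩
    fin_cases i <;> fin_cases j <;> assumption

variable [CompleteSpace K]

theorem star_opMatrix_fin_two (a b c d : K →L[ℂ] K) :
    star (opMatrix !![a, b; c, d]) = opMatrix !![star a, star c; star b, star d] := by
  rw [star_opMatrix]
  congr 1
  ext i j : 2
  fin_cases i <;> fin_cases j <;> rfl

theorem mem_generatedVNA_singleton {B a : K →L[ℂ] K} (hB : IsSelfAdjoint B) :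
    a ∈ (generatedVNA {B} : Set (K →L[ℂ] K)) ↔ ∀ x, Commute B x → Commute x a := by
  rw [coe_generatedVNA (by simp [hB.star_eq])]
  simp only [Set.mem_centralizer_iff, Set.mem_singleton_iff, forall_eq]
  rfl

/-- `(W*(B)⁽²⁾)′ = M₂({B}′)`. -/
theorem centralizer_inflation {B : K →L[ℂ] K} (hB : IsSelfAdjoint B) :
    (inflation (generatedVNA {B} : Set (K →L[ℂ] K))).centralizer =
      matrixAlg (Set.centralizer {B}) := by
  ext A
  obtain ⟨a, b, c, d, rfl⟩ := exists_opMatrix_fin_two A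
  rw [mem_matrixAlg_iff]
  have hcent : ∀ x, x ∈ Set.centralizer {B} ↔ Commute B x := fun x => by
    simp only [Set.mem_centralizer_iff, Set.mem_singleton_iff, forall_eq]; rfl
  simp only [hcent]
  constructor
  · intro h
    exact commute_opMatrix_diagonal_iff.1 (h _ ⟨B, subset_generatedVNA _ rfl, rfl⟩)
  · rintro ⟨h1, h2, h3, h4⟩ _ ⟨R, hR, rfl⟩
    rw [mem_generatedVNA_singleton hB] at hR
    exact commute_opMatrix_diagonal_iff.2
      ⟨(hR _ h1).symm, (hR _ h2).symm, (hR _ h3).symm, (hR _ h4).symm⟩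

/-- The operator matrix `½ [[1 + s, t], [t*, 1 - s]]`. -/
def symmetryProjection (s t : K →L[ℂ] K) : TwoFold K →L[ℂ] TwoFold K :=
  (2⁻¹ : ℂ) • opMatrix !![1 + s, t; star t, 1 - s]

/-- The matrix `[[s, t], [t*, -s]]` is self-adjoint, and the hypotheses make its square `1`; the
projection is `(1 + symmetry)/2`. -/
theorem isStarProjection_symmetryProjection {s t : K →L[ℂ] K} (hs : IsSelfAdjoint s)
    (hst : Commute s t) (h1 : t * star t = 1 - s * s) (h2 : star t * t = 1 - s * s) :
    IsStarProjection (symmetryProjection s t) := by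
  have hst' : s * star t = star t * s := by
    have := hst.star_star
    rw [hs.star_eq] at this
    exact this.eq
  refine ⟨?_, ?_⟩
  · rw [IsIdempotentElem, symmetryProjection, smul_mul_smul_comm, opMatrix_fin_two_mul,
      opMatrix_fin_two_smul, opMatrix_fin_two_smul, h1, h2, opMatrix_fin_two_inj]
    simp only [add_mul, mul_add, sub_mul, mul_sub, one_mul, mul_one, hst.eq, hst']
    refine ⟨?_, ?_, ?_, ?_⟩ <;> module
  · rw [IsSelfAdjoint, symmetryProjection, star_smul, star_opMatrix_fin_two]
    simp [hs.star_eq]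

variable {lam : ℝ} {B s g u : K →L[ℂ] K}

/-- A pair of projections on `K ⊕ K` with `lam P + Q = (1 + lam) / 2 + B ⊕ (-B)`, built from the
diagonal `s`, the modulus `g` and a unitary `u` of `{B}′`. -/
theorem symmetryProjection_mem_pencilPairs (hB : IsSelfAdjoint B) (hs : IsSelfAdjoint s)
    (hg : IsSelfAdjoint g) (hsc : ∀ x, Commute B x → Commute s x)
    (hgc : ∀ x, Commute B x → Commute g x) (hgg : g * g = 1 - s * s)
    (h : (lam : ℂ) • (B * s) = B * B + (((lam ^ 2 - 1) / 4 : ℝ) : ℂ) • (1 : K →L[ℂ] K))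
    (hu : u ∈ unitary (K →L[ℂ] K)) (hBu : Commute B u) :
    (symmetryProjection s (g * u),
      symmetryProjection ((2 : ℂ) • B - (lam : ℂ) • s) (-(lam : ℂ) • (g * u))) ∈
      pencilPairs ((((1 + lam) / 2 : ℝ) : ℂ) • 1 + opMatrix !![B, 0; 0, -B]) lam := by
  have hsB : Commute s B := hsc B (Commute.refl B)
  have hgs : Commute g s := hgc s hsB.symm
  have hgu : Commute g u := hgc u hBu
  have hsu : Commute s u := hsc u hBu
  have hgB : Commute g B := hgc B (Commute.refl B)
  have h1 : g * u * star (g * u) = 1 - s * s := by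
    rw [star_mul, hg.star_eq, mul_assoc, ← mul_assoc u, Unitary.mul_star_self_of_mem hu, one_mul,
      hgg]
  have h2 : star (g * u) * (g * u) = 1 - s * s := by
    rw [hgu.eq, star_mul, hg.star_eq, mul_assoc, ← mul_assoc (star u),
      Unitary.star_mul_self_of_mem hu, one_mul, hgg]
  have hst : Commute s (g * u) := hgs.symm.mul_right hsu
  have hBt : Commute B (g * u) := hgB.symm.mul_right hBu
  -- The symmetry `2Q - 1` has diagonal entry `2B - lam s` and off-diagonal entry `-lam g u`. The
  -- equation for `s` is precisely what makes these satisfy the relation between diagonal and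
  -- off-diagonal entries.
  have hs' : 1 - ((2 : ℂ) • B - (lam : ℂ) • s) * ((2 : ℂ) • B - (lam : ℂ) • s) =
      ((lam : ℂ) * lam) • (1 - s * s) := by
    have e : ((2 : ℂ) • B - (lam : ℂ) • s) * ((2 : ℂ) • B - (lam : ℂ) • s) =
        (4 : ℂ) • (B * B) - (4 : ℂ) • ((lam : ℂ) • (B * s)) + ((lam : ℂ) * lam) • (s * s) := by
      simp only [mul_sub, sub_mul, smul_mul_assoc, mul_smul_comm, smul_sub, smul_smul, hsB.eq]
      module
    rw [e, h]
    push_cast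
    module
  refine ⟨isStarProjection_symmetryProjection hs hst h1 h2,
    isStarProjection_symmetryProjection ?_ ?_ ?_ ?_, ?_⟩
  · rw [IsSelfAdjoint, star_sub, star_smul, star_smul, hB.star_eq, hs.star_eq]
    simp
  · exact ((hBt.smul_left _).sub_left (hst.smul_left _)).smul_right _
  · rw [star_smul, smul_mul_smul_comm, h1, hs']
    simp
  · rw [star_smul, smul_mul_smul_comm, h2, hs']
    simp
  · dsimp only
    rw [symmetryProjection, symmetryProjection, ← opMatrix_one_fin_two]
    simp only [opMatrix_fin_two_smul, opMatrix_fin_two_add, opMatrix_fin_two_inj, star_smul,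
      star_neg, RCLike.star_def, Complex.conj_ofReal]
    push_cast
    refine ⟨?_, ?_, ?_, ?_⟩ <;> module

/-- On `K ⊕ K`, the commutant of the projections of all the pairs is `W*(B)⁽²⁾`. -/
theorem centralizer_pencilOps_model (hlam0 : lam ≠ 0) (hB : B.IsPositive)
    (hBlower : StrictOpLT (((abs (1 - |lam|) / 2 : ℝ) : ℂ) • (1 : K →L[ℂ] K)) B)
    (hBupper : StrictOpLT B ((((1 + |lam|) / 2 : ℝ) : ℂ) • (1 : K →L[ℂ] K))) :
    (pencilPairs ((((1 + lam) / 2 : ℝ) : ℂ) • 1 + opMatrix !![B, 0; 0, -B]) lam).Nonempty ∧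
    (pencilOps ((((1 + lam) / 2 : ℝ) : ℂ) • 1 + opMatrix !![B, 0; 0, -B]) lam).centralizer =
      inflation (generatedVNA {B} : Set (K →L[ℂ] K)) := by
  have hBsa := hB.isSelfAdjoint
  have hB0 : 0 ≤ B := (ContinuousLinearMap.nonneg_iff_isPositive _).2 hB
  obtain ⟨s, g, hs, hg, hgi, hsc, hgc, hgg, h⟩ :=
    exists_diagonal_and_modulus hlam0 hBsa hBlower hBupper
  have hpair := fun u => symmetryProjection_mem_pencilPairs (u := u) hBsa hs hg hsc hgc hgg h
  have hne := hpair 1 (one_mem _) (Commute.one_right B)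
  set T := (((1 + lam) / 2 : ℝ) : ℂ) • 1 + opMatrix !![B, 0; 0, -B] with hT
  have hTB : T - (((1 + lam) / 2 : ℝ) : ℂ) • 1 = opMatrix !![B, 0; 0, -B] := by
    rw [hT, add_sub_cancel_left]
  have hsq : opMatrix !![B, 0; 0, -B] * opMatrix !![B, 0; 0, -B] =
      opMatrix !![B * B, 0; 0, B * B] := by
    rw [opMatrix_fin_two_mul]
    simp
  have hBinj : Function.Injective B := by
    have := injective_add_smul_one hBlower.1 hBlower.2 (c := abs (1 - |lam|) / 2) (by positivity)
    simpa using this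
  refine ⟨⟨_, hne⟩, Set.Subset.antisymm ?_ ?_⟩
  · intro A hA
    have hTA : Commute (T - (((1 + lam) / 2 : ℝ) : ℂ) • 1) A :=
      (commute_of_mem_centralizer_pencilOps ⟨_, hne⟩ hA).sub_left
        ((Commute.one_left A).smul_left _)
    rw [hTB] at hTA
    have hTA2 := hTA.mul_left hTA
    rw [hsq] at hTA2
    obtain ⟨a, b, c, d, rfl⟩ := exists_opMatrix_fin_two A
    obtain ⟨ha, hb, hc, hd⟩ := commute_opMatrix_diagonal_iff.1 hTA2
    replace ha := commute_of_commute_mul_self hB0 ha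
    replace hb := commute_of_commute_mul_self hB0 hb
    replace hc := commute_of_commute_mul_self hB0 hc
    rw [commute_iff_eq, opMatrix_fin_two_mul, opMatrix_fin_two_mul, opMatrix_fin_two_inj] at hTA
    obtain ⟨-, hb', hc', -⟩ := hTA
    -- An off-diagonal entry commutes with `B`, through `B²`, and anticommutes with it, through `B ⊕
    -- (-B)`; injectivity of `B` kills it.
    have hzero : ∀ x : K →L[ℂ] K, B * x = -(B * x) → x = 0 := fun x hx =>
      mul_left_cancel_of_injective hBinj (by
        rw [mul_zero, ← smul_eq_zero_iff_right (two_ne_zero (α := ℂ)), two_smul]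
        exact eq_neg_iff_add_eq_zero.1 hx)
    have hb0 : b = 0 := hzero b (by simpa [hb.eq] using hb')
    have hc0 : c = 0 := hzero c (by simpa [hc.eq, eq_comm] using hc')
    subst hb0 hc0
    -- This is the upper right entry of the commutation with `P`.
    have hoff : ∀ u ∈ unitary (K →L[ℂ] K), Commute B u → g * u * d = a * (g * u) := by
      intro u hu hBu
      have h1 : Commute (symmetryProjection s (g * u)) (opMatrix !![a, 0; 0, d]) :=
        hA _ ⟨_, hpair u hu hBu, Or.inl rfl⟩
      have h2 := h1.smul_left (2 : ℂ)
      rw [symmetryProjection, smul_smul, mul_inv_cancel₀ two_ne_zero, one_smul, commute_iff_eq,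
        opMatrix_fin_two_mul, opMatrix_fin_two_mul, opMatrix_fin_two_inj] at h2
      simpa using h2.2.1
    have hga : g * a = a * g := (hgc a ha).eq
    have hda : d = a := mul_left_cancel_of_injective hgi (by
      have := hoff 1 (one_mem _) (Commute.one_right B)
      rwa [mul_one, ← hga] at this)
    subst hda
    refine ⟨d, mem_double_commutant_of_commute_unitary hBsa fun u hu hBu => ?_, rfl⟩
    refine mul_left_cancel_of_injective hgi ?_
    rw [← mul_assoc, hga, mul_assoc, ← hoff u hu hBu, mul_assoc]
  · rintro _ ⟨R, hR, rfl⟩ A hA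
    rw [mem_generatedVNA_singleton hBsa] at hR
    have h1 := commute_sq_of_mem_pencilOps hA
    rw [hTB, hsq] at h1
    obtain ⟨a, b, c, d, rfl⟩ := exists_opMatrix_fin_two A
    obtain ⟨ha, hb, hc, hd⟩ := commute_opMatrix_diagonal_iff.1 h1
    exact (commute_opMatrix_diagonal_iff.2
      ⟨(hR _ (commute_of_commute_mul_self hB0 ha)).symm,
        (hR _ (commute_of_commute_mul_self hB0 hb)).symm,
        (hR _ (commute_of_commute_mul_self hB0 hc)).symm,
        (hR _ (commute_of_commute_mul_self hB0 hd)).symm⟩).symm.eq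

end Model

/-! ### Commutants of `ℂI` and `𝓑(M)` -/

section Scalars

theorem commute_smul_one {M : Type*} [NormedAddCommGroup M] [InnerProductSpace ℂ M]
    (A : M →L[ℂ] M) (c : ℂ) : Commute A (c • (1 : M →L[ℂ] M)) :=
  (Commute.one_right A).smul_right c

variable {M : Type*} [NormedAddCommGroup M] [InnerProductSpace ℂ M] [CompleteSpace M]

/-- An operator commuting with all orthogonal projections is a scalar. -/
theorem exists_eq_smul_one_of_commute_projections {A : M →L[ℂ] M}
    (h : ∀ P : M →L[ℂ] M, IsStarProjection P → Commute P A) :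
    ∃ c : ℂ, A = c • (1 : M →L[ℂ] M) := by
  -- Commuting with the projection onto the line through `x` makes `x` an eigenvector.
  have hspan : ∀ x : M, ∃ c : ℂ, c • x = A x := by
    intro x
    rw [← Submodule.mem_span_singleton]
    have h1 := h _ (isStarProjection_starProjection (U := ℂ ∙ x))
    have h2 := congrArg (fun B : M →L[ℂ] M => B x) h1.eq
    simp only [mul_apply_eq_comp] at h2
    rw [Submodule.starProjection_eq_self_iff.2 (Submodule.mem_span_singleton_self x)] at h2
    exact Submodule.starProjection_eq_self_iff.1 h2
  obtain ⟨c, hc⟩ := LinearMap.exists_eq_smul_id_of_forall_notLinearIndependent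
    (f := A.toLinearMap) (fun v hv => by
      obtain ⟨c, hc⟩ := hspan v
      have := (LinearIndependent.pair_iff.1 hv) c (-1) (by rw [hc]; simp)
      simp at this)
  exact ⟨c, ContinuousLinearMap.ext fun x => congrArg (fun f => f x) hc⟩

variable {H : Type*} [NormedAddCommGroup H] [InnerProductSpace ℂ H]

/-- The commutant of a summand of a direct sum of operator algebras. -/
def Summand.commutant (s : Summand H) : Summand H := ⟨s.space, s.ops.centralizer⟩

theorem commutant_scalarOps (M : Submodule ℂ H) : (scalarOps M).commutant = allOps M := by
  refine congrArg (Summand.mk M) (Set.eq_univ_of_forall ?_)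
  rintro A _ ⟨c, rfl⟩
  exact (commute_smul_one (M := M) A c).symm.eq

theorem commutant_allOps (M : Submodule ℂ H) [CompleteSpace M] :
    (allOps M).commutant = scalarOps M := by
  refine congrArg (Summand.mk M) (Set.Subset.antisymm ?_ ?_)
  · exact fun A hA => exists_eq_smul_one_of_commute_projections (M := M) fun P _ => hA P trivial
  · rintro _ ⟨c, rfl⟩ A -
    exact (commute_smul_one (M := M) A c).eq

end Scalars

/-! ### Direct sums, gluing of pairs, and localisation of commutants -/

section Decomposition

variable {H : Type*} [NormedAddCommGroup H] [InnerProductSpace ℂ H] {ι : Type*}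

/-- The subspaces `M i` are mutually orthogonal and span a dense subspace. -/
structure IsOrthogonalDecomposition (M : ι → Submodule ℂ H) : Prop where
  pairwise : Pairwise fun i j => M i ⟂ M j
  total : ∀ x, (∀ i, x ∈ (M i)ᗮ) → x = 0

/-- The direct sum `⊕ 𝒜ᵢ` of operator algebras with respect to `H = ⊕ Mᵢ`. -/
def familyOps (s : ι → Summand H) : Set (H →L[ℂ] H) :=
  {A | ∀ i, ∃ a ∈ (s i).ops, ∀ x : (s i).space, A (x : H) = (a x : H)}

/-- The extension by zero to `H` of an operator on the subspace `M`. -/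
def extendByZero (M : Submodule ℂ H) [CompleteSpace M] (a : M →L[ℂ] M) : H →L[ℂ] H :=
  M.subtypeL ∘L a ∘L M.orthogonalProjectionOnto

theorem extendByZero_apply_coe (M : Submodule ℂ H) [CompleteSpace M] (a : M →L[ℂ] M) (x : M) :
    extendByZero M a x = a x := by
  simp [extendByZero]

theorem extendByZero_apply_of_isOrtho {M N : Submodule ℂ H} [CompleteSpace M] (a : M →L[ℂ] M)
    (h : N ⟂ M) {x : H} (hx : x ∈ N) : extendByZero M a x = 0 := by
  simp [extendByZero, Submodule.orthogonalProjectionOnto_apply_of_mem_orthogonal (h hx)]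

theorem extendByZero_mem (M : Submodule ℂ H) [CompleteSpace M] (a : M →L[ℂ] M) (x : H) :
    extendByZero M a x ∈ M :=
  (a (M.orthogonalProjectionOnto x)).2

/-- The operator on `H` acting as `a i` on each `M i`. -/
def glue [Fintype ι] (M : ι → Submodule ℂ H) [∀ i, CompleteSpace (M i)] (a : ∀ i, M i →L[ℂ] M i) :
    H →L[ℂ] H :=
  ∑ i, extendByZero (M i) (a i)

theorem glue_apply [Fintype ι] {M : ι → Submodule ℂ H} [∀ i, CompleteSpace (M i)]
    (hM : IsOrthogonalDecomposition M) (a : ∀ i, M i →L[ℂ] M i) (i : ι) (x : M i) :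
    glue M a x = a i x := by
  rw [glue, sum_apply, Finset.sum_eq_single i]
  · exact extendByZero_apply_coe _ _ x
  · exact fun j _ hj => extendByZero_apply_of_isOrtho _ (hM.pairwise hj.symm) x.2
  · simp

variable [CompleteSpace H]

theorem star_extendByZero (M : Submodule ℂ H) [CompleteSpace M] (a : M →L[ℂ] M) :
    star (extendByZero M a) = extendByZero M (star a) := by
  simp only [extendByZero, ContinuousLinearMap.star_eq_adjoint, ContinuousLinearMap.adjoint_comp,
    Submodule.adjoint_subtypeL, Submodule.adjoint_orthogonalProjectionOnto]
  rfl

/-- The kernel of `A - B` is closed and contains every `M i`, and only `0` is orthogonal to all of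
these. -/
theorem IsOrthogonalDecomposition.ext {M : ι → Submodule ℂ H} (hM : IsOrthogonalDecomposition M)
    {A B : H →L[ℂ] H} (h : ∀ i, ∀ x : M i, A x = B x) : A = B := by
  have hN : ∀ i, M i ≤ LinearMap.ker (A - B).toLinearMap := fun i x hx => by
    simpa [sub_eq_zero] using h i ⟨x, hx⟩
  have hclosed : IsClosed (LinearMap.ker (A - B).toLinearMap : Set H) := (A - B).isClosed_ker
  have : CompleteSpace (LinearMap.ker (A - B).toLinearMap) := hclosed.completeSpace_coe
  have htop : LinearMap.ker (A - B).toLinearMap = ⊤ := by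
    rw [← Submodule.orthogonal_eq_bot_iff, Submodule.eq_bot_iff]
    exact fun x hx => hM.total x fun i => Submodule.orthogonal_le (hN i) hx
  ext x
  have : x ∈ LinearMap.ker (A - B).toLinearMap := htop ▸ Submodule.mem_top
  simpa [sub_eq_zero] using this

/-- The commutant of a direct sum of operator algebras. -/
theorem centralizer_familyOps {s : ι → Summand H} [∀ i, CompleteSpace (s i).space]
    (hs : IsOrthogonalDecomposition fun i => (s i).space) (h0 : ∀ i, 0 ∈ (s i).ops)
    (h1 : ∀ i, 1 ∈ (s i).ops) :
    (familyOps s).centralizer = familyOps fun i => (s i).commutant := by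
  classical
  refine Set.Subset.antisymm ?_ ?_
  · intro X hX i
    -- Extensions by zero belong to the direct sum because every summand contains `0`. For `a = 1`
    -- the extension is the projection onto the summand, so `X` preserves the summand.
    have hext : ∀ a ∈ (s i).ops, Commute (extendByZero (s i).space a) X := by
      refine fun a ha => hX _ fun j => ?_
      by_cases hj : j = i
      · subst hj
        exact ⟨a, ha, extendByZero_apply_coe _ a⟩
      · exact ⟨0, h0 j, fun x => by
          simpa using extendByZero_apply_of_isOrtho a (hs.pairwise hj) x.2⟩
    have hmem : ∀ x ∈ (s i).space, X x ∈ (s i).space := by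
      intro x hx
      have h := congrArg (fun B : H →L[ℂ] H => B x) (hext 1 (h1 i)).eq
      simp only [mul_apply_eq_comp] at h
      rw [extendByZero_apply_coe _ _ ⟨x, hx⟩] at h
      have h2 : X x = _ := h.symm
      rw [h2]
      exact extendByZero_mem _ _ _
    refine ⟨X.restrict hmem, fun a ha => ?_, fun x => rfl⟩
    ext x
    have h := congrArg (fun B : H →L[ℂ] H => B x) (hext a ha).eq
    simp only [mul_apply_eq_comp] at h
    rw [extendByZero_apply_coe, extendByZero_apply_coe _ a ⟨X x, hmem x x.2⟩] at h
    exact h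
  · intro X hX A hA
    refine hs.ext fun i x => ?_
    have hXi : ∃ b ∈ (s i).ops.centralizer, ∀ x : (s i).space, X x = b x := hX i
    obtain ⟨b, hb, hXb⟩ := hXi
    obtain ⟨a, ha, hAa⟩ := hA i
    have h := congrArg (fun B : (s i).space →L[ℂ] (s i).space => (B x : H)) (hb a ha)
    change A (X x) = X (A x)
    rw [hXb x, hAa x, hAa, hXb]
    exact h

variable [Fintype ι]

variable {M : ι → Submodule ℂ H} [∀ i, CompleteSpace (M i)]

theorem isStarProjection_glue (hM : IsOrthogonalDecomposition M) {p : ∀ i, M i →L[ℂ] M i}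
    (hp : ∀ i, IsStarProjection (p i)) : IsStarProjection (glue M p) := by
  refine ⟨hM.ext fun i x => ?_, ?_⟩
  · rw [mul_apply_eq_comp, glue_apply hM, glue_apply hM]
    exact congrArg (fun B : M i →L[ℂ] M i => (B x : H)) (hp i).isIdempotentElem
  · simp [IsSelfAdjoint, glue, star_sum, star_extendByZero, (hp _).isSelfAdjoint.star_eq]

theorem glue_mem_pencilPairs (hM : IsOrthogonalDecomposition M) {T : H →L[ℂ] H} {lam : ℝ}
    {t : ∀ i, M i →L[ℂ] M i} (hT : ∀ i, ∀ x : M i, T x = t i x)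
    {p : ∀ i, (M i →L[ℂ] M i) × (M i →L[ℂ] M i)} (hp : ∀ i, p i ∈ pencilPairs (t i) lam) :
    (glue M fun i => (p i).1, glue M fun i => (p i).2) ∈ pencilPairs T lam := by
  refine ⟨isStarProjection_glue hM fun i => (hp i).1, isStarProjection_glue hM fun i => (hp i).2.1,
    hM.ext fun i x => ?_⟩
  rw [hT, (hp i).2.2]
  simp [glue_apply hM]

theorem isStarProjection_restrict {N : Submodule ℂ H} [CompleteSpace N] {P : H →L[ℂ] H}
    (hP : IsStarProjection P) (h : ∀ x ∈ N, P x ∈ N) : IsStarProjection (P.restrict h) := by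
  refine ⟨?_, ?_⟩
  · ext x
    exact congrArg (fun B : H →L[ℂ] H => B x) hP.isIdempotentElem
  · rw [ContinuousLinearMap.isSelfAdjoint_iff_isSymmetric]
    intro x y
    exact hP.isSelfAdjoint.isSymmetric x y

/-- The summand `s` reduces `T` and all the projections of the pairs, and its operators are the
commutant of the pairs of the part of `T` in it. -/
structure IsPencilCommutant (T : H →L[ℂ] H) (lam : ℝ) (s : Summand H) [CompleteSpace s.space] :
    Prop where
  mem_of_commute : ∀ A, Commute T A → ∀ x ∈ s.space, A x ∈ s.space
  mem_of_pencilOps : ∀ A ∈ pencilOps T lam, ∀ x ∈ s.space, A x ∈ s.space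
  exists_part : ∃ t : s.space →L[ℂ] s.space, (∀ x : s.space, T x = t x) ∧
    (pencilPairs t lam).Nonempty ∧ s.ops = (pencilOps t lam).centralizer

theorem restrict_mem_pencilOps {T : H →L[ℂ] H} {lam : ℝ} {N : Submodule ℂ H} [CompleteSpace N]
    {t : N →L[ℂ] N} (ht : ∀ x : N, T x = t x)
    (hmem : ∀ A ∈ pencilOps T lam, ∀ x ∈ N, A x ∈ N) {A : H →L[ℂ] H} (hA : A ∈ pencilOps T lam) :
    A.restrict (hmem A hA) ∈ pencilOps t lam := by
  have key : ∀ p (hp : p ∈ pencilPairs T lam),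
      (p.1.restrict (hmem p.1 ⟨p, hp, Or.inl rfl⟩), p.2.restrict (hmem p.2 ⟨p, hp, Or.inr rfl⟩)) ∈
        pencilPairs t lam := by
    intro p hp
    refine ⟨isStarProjection_restrict hp.1 (hmem p.1 ⟨p, hp, Or.inl rfl⟩),
      isStarProjection_restrict hp.2.1 (hmem p.2 ⟨p, hp, Or.inr rfl⟩), ?_⟩
    ext x
    rw [← ht]
    exact congrArg (fun B : H →L[ℂ] H => B x) hp.2.2
  obtain ⟨p, hp, rfl | rfl⟩ := id hA
  exacts [⟨_, key p hp, Or.inl rfl⟩, ⟨_, key p hp, Or.inr rfl⟩]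

/-- Every pair on `H` restricts to pairs of the parts, and any choice of pairs of the parts glues to
a pair on `H`. -/
theorem centralizer_pencilOps_eq_familyOps {T : H →L[ℂ] H} {lam : ℝ} {s : ι → Summand H}
    [∀ i, CompleteSpace (s i).space] (hs : IsOrthogonalDecomposition fun i => (s i).space)
    (h : ∀ i, IsPencilCommutant T lam (s i)) :
    (pencilOps T lam).centralizer = familyOps s := by
  classical
  choose t ht hne hops using fun i => (h i).exists_part
  choose p hp using hne
  refine Set.Subset.antisymm ?_ ?_
  · intro A hA i
    have hTA := commute_of_mem_centralizer_pencilOps ⟨_, glue_mem_pencilPairs hs ht hp⟩ hA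
    refine ⟨A.restrict ((h i).mem_of_commute A hTA), ?_, fun x => rfl⟩
    rw [hops i]
    have key : ∀ q ∈ pencilPairs (t i) lam, q.1 * A.restrict ((h i).mem_of_commute A hTA) =
        A.restrict ((h i).mem_of_commute A hTA) * q.1 ∧
        q.2 * A.restrict ((h i).mem_of_commute A hTA) =
        A.restrict ((h i).mem_of_commute A hTA) * q.2 := by
      intro q hq
      -- The arbitrary pair `q` is placed on summand `i`, and the fixed choice is kept on all the
      -- others.
      have hp' : ∀ j, Function.update p i q j ∈ pencilPairs (t j) lam := by
        intro j
        by_cases hj : j = i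
        · subst hj; simpa using hq
        · simpa [hj] using hp j
      have hpair := glue_mem_pencilPairs hs ht hp'
      have e1 := hA _ ⟨_, hpair, Or.inl rfl⟩
      have e2 := hA _ ⟨_, hpair, Or.inr rfl⟩
      constructor
      · ext x
        have := congrArg (fun B : H →L[ℂ] H => B x) e1
        simp only [mul_apply_eq_comp] at this
        rw [glue_apply hs, glue_apply hs _ i ⟨A x, (h i).mem_of_commute A hTA x x.2⟩] at this
        simp only [Function.update_self] at this
        exact this
      · ext x
        have := congrArg (fun B : H →L[ℂ] H => B x) e2
        simp only [mul_apply_eq_comp] at this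
        rw [glue_apply hs, glue_apply hs _ i ⟨A x, (h i).mem_of_commute A hTA x x.2⟩] at this
        simp only [Function.update_self] at this
        exact this
    rintro _ ⟨q, hq, rfl | rfl⟩
    exacts [(key q hq).1, (key q hq).2]
  · intro A hA P hP
    refine hs.ext fun i x => ?_
    obtain ⟨a, ha, hAa⟩ := hA i
    rw [hops i] at ha
    have h1 := ha _ (restrict_mem_pencilOps (ht i) (h i).mem_of_pencilOps hP)
    have h2 := congrArg (fun B : (s i).space →L[ℂ] (s i).space => (B x : H)) h1
    change P (A x) = A (P x)
    rw [hAa x, hAa ⟨P x, (h i).mem_of_pencilOps P hP x x.2⟩]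
    exact h2

end Decomposition

/-! ### The four null spaces and the generic space -/

section NullSpaces

variable {H : Type*} [NormedAddCommGroup H] [InnerProductSpace ℂ H]

theorem mem_nullSpace_iff {T : H →L[ℂ] H} {c : ℝ} {x : H} :
    x ∈ nullSpace T c ↔ T x = (c : ℂ) • x := by
  simp [nullSpace, sub_eq_zero]

theorem map_mem_nullSpace_of_commute {T A : H →L[ℂ] H} (h : Commute T A) {c : ℝ} {x : H}
    (hx : x ∈ nullSpace T c) : A x ∈ nullSpace T c := by
  rw [mem_nullSpace_iff] at hx ⊢
  have := congrArg (fun B : H →L[ℂ] H => B x) h.eq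
  simp only [mul_apply_eq_comp] at this
  rw [this, hx, map_smul]

theorem mem_genericSpace_iff {T : H →L[ℂ] H} {lam : ℝ} {x : H} :
    x ∈ genericSpace T lam ↔ ∀ c : ℝ, c = 0 ∨ c = 1 ∨ c = lam ∨ c = 1 + lam →
      x ∈ (nullSpace T c)ᗮ := by
  simp only [genericSpace, ← Submodule.inf_orthogonal, Submodule.mem_inf, forall_eq_or_imp,
    forall_eq]
  tauto

theorem nullSpace_isOrtho_genericSpace {T : H →L[ℂ] H} {lam c : ℝ}
    (hc : c = 0 ∨ c = 1 ∨ c = lam ∨ c = 1 + lam) : nullSpace T c ⟂ genericSpace T lam :=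
  Submodule.IsOrtho.symm fun _ hx => mem_genericSpace_iff.1 hx c hc

variable [CompleteSpace H]

instance completeSpace_nullSpace (T : H →L[ℂ] H) (c : ℝ) : CompleteSpace (nullSpace T c) :=
  (T - (c : ℂ) • (1 : H →L[ℂ] H)).isClosed_ker.completeSpace_coe

instance completeSpace_genericSpace (T : H →L[ℂ] H) (lam : ℝ) :
    CompleteSpace (genericSpace T lam) :=
  inferInstanceAs (CompleteSpace
    ↥(nullSpace T 0 ⊔ nullSpace T 1 ⊔ nullSpace T lam ⊔ nullSpace T (1 + lam))ᗮ)

theorem nullSpace_isOrtho {T : H →L[ℂ] H} (hT : IsSelfAdjoint T) {a b : ℝ} (hab : a ≠ b) :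
    nullSpace T a ⟂ nullSpace T b := by
  rw [Submodule.isOrtho_iff_inner_eq]
  intro u hu v hv
  rw [mem_nullSpace_iff] at hu hv
  have hs : inner ℂ (T u) v = inner ℂ u (T v) := hT.isSymmetric u v
  rw [hu, hv, inner_smul_left, inner_smul_right, Complex.conj_ofReal, ← sub_eq_zero,
    ← sub_mul] at hs
  refine (mul_eq_zero.1 hs).resolve_left ?_
  exact sub_ne_zero.2 (by exact_mod_cast hab)

theorem map_mem_genericSpace_of_star {T A : H →L[ℂ] H} {lam : ℝ}
    (h : ∀ c : ℝ, c = 0 ∨ c = 1 ∨ c = lam ∨ c = 1 + lam →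
      ∀ x ∈ nullSpace T c, star A x ∈ nullSpace T c) :
    ∀ x ∈ genericSpace T lam, A x ∈ genericSpace T lam := by
  intro x hx
  rw [mem_genericSpace_iff] at hx ⊢
  intro c hc
  rw [Submodule.mem_orthogonal]
  intro u hu
  rw [← ContinuousLinearMap.adjoint_inner_left]
  exact Submodule.inner_right_of_mem_orthogonal (h c hc u hu) (hx c hc)

/-- If `r P x = Q x` for projections `P`, `Q` and a real number `r ≠ 0, 1`, then
`P x = Q x = 0`. -/
theorem projections_apply_eq_zero {P Q : H →L[ℂ] H} (hP : IsStarProjection P)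
    (hQ : IsStarProjection Q) {r : ℝ} (hr0 : r ≠ 0) (hr1 : r ≠ 1) {x : H}
    (h : (r : ℂ) • P x = Q x) : P x = 0 ∧ Q x = 0 := by
  have hinner : ∀ R : H →L[ℂ] H, IsStarProjection R → inner ℂ (R x) x = inner ℂ (R x) (R x) := by
    intro R hR
    have h1 : inner ℂ (R (R x)) x = inner ℂ (R x) (R x) := hR.isSelfAdjoint.isSymmetric _ _
    have h2 : R (R x) = R x := congrArg (fun B : H →L[ℂ] H => B x) hR.isIdempotentElem
    rw [← h1, h2]
  have h1 := hinner Q hQ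
  rw [← h, inner_smul_left, inner_smul_left, inner_smul_right, hinner P hP,
    Complex.conj_ofReal, ← sub_eq_zero] at h1
  have h2 : (r : ℂ) * (1 - r) * inner ℂ (P x) (P x) = 0 := by
    rw [← h1]; ring
  have h3 : P x = 0 := by
    rw [← inner_self_eq_zero (𝕜 := ℂ)]
    refine (mul_eq_zero.1 h2).resolve_left (mul_ne_zero (by exact_mod_cast hr0) ?_)
    rw [sub_ne_zero]
    exact_mod_cast hr1.symm
  exact ⟨h3, by rw [← h, h3, smul_zero]⟩

/-- On the null space of `T - (lam e + f)` with `e, f ∈ {0, 1}` (and `e = f` if `lam = 1`), the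
projections of a pair act as the scalars `e` and `f`. -/
theorem pencilPairs_apply {T : H →L[ℂ] H} {lam : ℝ} (hlam0 : lam ≠ 0) (hlam1 : lam ≠ -1)
    {e f : ℝ} (he : e = 0 ∨ e = 1) (hf : f = 0 ∨ f = 1) (hef : lam = 1 → e = f)
    {p : (H →L[ℂ] H) × (H →L[ℂ] H)} (hp : p ∈ pencilPairs T lam) {x : H}
    (hx : x ∈ nullSpace T (lam * e + f)) : p.1 x = (e : ℂ) • x ∧ p.2 x = (f : ℂ) • x := by
  obtain ⟨P, Q⟩ := p
  obtain ⟨hP, hQ, hT⟩ := hp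
  dsimp only at hP hQ hT ⊢
  rw [mem_nullSpace_iff, hT] at hx
  have hx' : (lam : ℂ) • P x + Q x = ((lam * e + f : ℝ) : ℂ) • x := hx
  push_cast at hx'
  have hn0 : -lam ≠ 0 := neg_ne_zero.2 hlam0
  have hn1 : -lam ≠ 1 := fun h => hlam1 (by linarith)
  have hQx : Q x = ((lam : ℂ) * e + f) • x - (lam : ℂ) • P x := eq_sub_of_add_eq' hx'
  -- Replacing `P` by `1 - P` if `e = 1` and `Q` by `1 - Q` if `f = 1` turns the eigenvalue equation
  -- into `r P x = Q x`, with `r = -lam` if `e = f` and `r = lam` otherwise.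
  rcases he with rfl | rfl <;> rcases hf with rfl | rfl
  · have := projections_apply_eq_zero hP hQ hn0 hn1 (x := x) (by rw [hQx]; push_cast; module)
    simpa using this
  · have := projections_apply_eq_zero hP hQ.one_sub hlam0 (fun h => zero_ne_one (hef h)) (x := x)
      (by rw [sub_apply, one_apply_eq_self, hQx]; push_cast; module)
    simpa [sub_eq_zero, eq_comm (b := x)] using this
  · have := projections_apply_eq_zero hP.one_sub hQ hlam0 (fun h => one_ne_zero (hef h)) (x := x)
      (by rw [sub_apply, one_apply_eq_self, hQx]; push_cast; module)
    simpa [sub_eq_zero, eq_comm (b := x)] using this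
  · have := projections_apply_eq_zero hP.one_sub hQ.one_sub hn0 hn1 (x := x)
      (by rw [sub_apply, sub_apply, one_apply_eq_self, hQx]; push_cast; module)
    simpa [sub_eq_zero, eq_comm (b := x)] using this

theorem map_mem_nullSpace_of_mem_pencilOps {T : H →L[ℂ] H} {lam : ℝ} (hlam0 : lam ≠ 0)
    (hlam1 : lam ≠ -1) {c : ℝ} (hc : c = 0 ∨ c = 1 ∨ c = lam ∨ c = 1 + lam) {A : H →L[ℂ] H}
    (hA : A ∈ pencilOps T lam) {x : H} (hx : x ∈ nullSpace T c) : A x ∈ nullSpace T c := by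
  -- Here the projections need not be scalar on the null space, but `P x + Q x = x` gives `Q P x =
  -- 0`, so `P x` and `Q x` are again fixed by `T`.
  by_cases hspecial : lam = 1 ∧ c = 1
  · obtain ⟨rfl, rfl⟩ := hspecial
    obtain ⟨⟨P, Q⟩, ⟨hP, hQ, hT⟩, hA⟩ := hA
    dsimp only at hP hQ hT hA
    have hPP : P (P x) = P x := congrArg (fun B : H →L[ℂ] H => B x) hP.isIdempotentElem
    have hQQ : Q (Q x) = Q x := congrArg (fun B : H →L[ℂ] H => B x) hQ.isIdempotentElem
    rw [mem_nullSpace_iff, hT] at hx ⊢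
    simp only [Complex.ofReal_one, one_smul, add_apply] at hx ⊢
    have hQx : Q x = x - P x := eq_sub_of_add_eq' hx
    have hQPx : Q (P x) = 0 := by
      have : P x = x - Q x := eq_sub_of_add_eq hx
      rw [this, map_sub, hQQ, sub_self]
    rcases hA with rfl | rfl
    · rw [hPP, hQPx, add_zero]
    · rw [hQQ, hQx, map_sub, hPP, sub_self, zero_add]
  · obtain ⟨e, f, he, hf, hef, rfl⟩ : ∃ e f : ℝ, (e = 0 ∨ e = 1) ∧ (f = 0 ∨ f = 1) ∧
        (lam = 1 → e = f) ∧ c = lam * e + f := by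
      rcases hc with rfl | rfl | rfl | rfl
      · exact ⟨0, 0, by simp⟩
      · exact ⟨0, 1, by simp, by simp, fun h => absurd ⟨h, rfl⟩ hspecial, by simp⟩
      · exact ⟨1, 0, by simp, by simp, fun h => absurd ⟨h, h⟩ hspecial, by simp⟩
      · exact ⟨1, 1, by simp, by simp, fun _ => rfl, by ring⟩
    obtain ⟨p, hp, rfl | rfl⟩ := hA
    · rw [(pencilPairs_apply hlam0 hlam1 he hf hef hp hx).1]
      exact Submodule.smul_mem _ _ hx
    · rw [(pencilPairs_apply hlam0 hlam1 he hf hef hp hx).2]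
      exact Submodule.smul_mem _ _ hx

/-- For `T = lam e + f` with `e, f ∈ {0, 1}` (and `e = f` if `lam = 1`), the only pair is
`(e, f)`, and every operator commutes with it. -/
theorem centralizer_pencilOps_smul_one {lam : ℝ} (hlam0 : lam ≠ 0) (hlam1 : lam ≠ -1)
    {e f c : ℝ} (he : e = 0 ∨ e = 1) (hf : f = 0 ∨ f = 1) (hef : lam = 1 → e = f)
    (hc : c = lam * e + f) :
    (pencilPairs ((c : ℂ) • (1 : H →L[ℂ] H)) lam).Nonempty ∧
      (pencilOps ((c : ℂ) • (1 : H →L[ℂ] H)) lam).centralizer = Set.univ := by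
  subst hc
  constructor
  · have hproj : ∀ d : ℝ, d = 0 ∨ d = 1 → IsStarProjection ((d : ℂ) • (1 : H →L[ℂ] H)) := by
      rintro d (rfl | rfl)
      · simp [IsStarProjection.zero]
      · simp [IsStarProjection.one]
    refine ⟨((e : ℂ) • 1, (f : ℂ) • 1), hproj e he, hproj f hf, ?_⟩
    dsimp only
    rw [smul_smul, ← add_smul]
    push_cast
    rfl
  · refine Set.eq_univ_of_forall fun A => ?_
    have hall : ∀ x : H,
        x ∈ nullSpace (((lam * e + f : ℝ) : ℂ) • (1 : H →L[ℂ] H)) (lam * e + f) := fun x => by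
      simp [mem_nullSpace_iff]
    rintro _ ⟨p, hp, rfl | rfl⟩
    · have : p.1 = (e : ℂ) • (1 : H →L[ℂ] H) := ContinuousLinearMap.ext fun x =>
        (pencilPairs_apply hlam0 hlam1 he hf hef hp (hall x)).1
      rw [this]
      exact (commute_smul_one A e).symm.eq
    · have : p.2 = (f : ℂ) • (1 : H →L[ℂ] H) := ContinuousLinearMap.ext fun x =>
        (pencilPairs_apply hlam0 hlam1 he hf hef hp (hall x)).2
      rw [this]
      exact (commute_smul_one A f).symm.eq

/-- The pairs of projections with `P + Q = 1` are the pairs `(P, 1 - P)`. -/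
theorem centralizer_pencilOps_one :
    (pencilPairs (1 : H →L[ℂ] H) 1).Nonempty ∧
      (pencilOps (1 : H →L[ℂ] H) 1).centralizer = {a | ∃ c : ℂ, a = c • (1 : H →L[ℂ] H)} := by
  have hpair : ∀ P : H →L[ℂ] H, IsStarProjection P →
      (P, 1 - P) ∈ pencilPairs (1 : H →L[ℂ] H) 1 := fun P hP => ⟨hP, hP.one_sub, by simp⟩
  refine ⟨⟨_, hpair 0 (IsStarProjection.zero _)⟩, Set.Subset.antisymm ?_ ?_⟩
  · exact fun A hA => exists_eq_smul_one_of_commute_projections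
      fun P hP => hA P ⟨_, hpair P hP, Or.inl rfl⟩
  · rintro _ ⟨c, rfl⟩ A -
    exact (commute_smul_one A c).eq

/-- The null space of `T - (lam e + f)` contributes `𝓑(N(T - (lam e + f)))` to the commutant. -/
theorem isPencilCommutant_allOps (T : H →L[ℂ] H) {lam : ℝ} (hlam0 : lam ≠ 0) (hlam1 : lam ≠ -1)
    {e f c : ℝ} (he : e = 0 ∨ e = 1) (hf : f = 0 ∨ f = 1) (hef : lam = 1 → e = f)
    (hc : c = lam * e + f) (hc' : c = 0 ∨ c = 1 ∨ c = lam ∨ c = 1 + lam)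
    [CompleteSpace (allOps (nullSpace T c)).space] :
    IsPencilCommutant T lam (allOps (nullSpace T c)) := by
  have h := centralizer_pencilOps_smul_one (H := nullSpace T c) hlam0 hlam1 he hf hef hc
  exact ⟨fun A hA x hx => map_mem_nullSpace_of_commute hA hx,
    fun A hA x hx => map_mem_nullSpace_of_mem_pencilOps hlam0 hlam1 hc' hA hx,
    (c : ℂ) • (1 : nullSpace T c →L[ℂ] nullSpace T c), fun x => mem_nullSpace_iff.1 x.2, h.1,
    h.2.symm⟩

/-- If `lam = 1`, then the null space of `T - I` contributes only scalars to the commutant. -/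
theorem isPencilCommutant_scalarOps (T : H →L[ℂ] H)
    [CompleteSpace (scalarOps (nullSpace T 1)).space] :
    IsPencilCommutant T 1 (scalarOps (nullSpace T 1)) := by
  have h := centralizer_pencilOps_one (H := nullSpace T 1)
  refine ⟨fun A hA x hx => map_mem_nullSpace_of_commute hA hx,
    fun A hA x hx => map_mem_nullSpace_of_mem_pencilOps one_ne_zero (by norm_num)
      (Or.inr (Or.inl rfl)) hA hx,
    (1 : nullSpace T 1 →L[ℂ] nullSpace T 1), fun x => ?_, h.1, h.2.symm⟩
  have hx := mem_nullSpace_iff.1 x.2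
  rwa [Complex.ofReal_one, one_smul] at hx

end NullSpaces

/-! ### Transport of pairs and commutants along a unitary -/

section Conjugation

variable {E F : Type*} [NormedAddCommGroup E] [InnerProductSpace ℂ E]
  [NormedAddCommGroup F] [InnerProductSpace ℂ F] (V : E ≃ₗᵢ[ℂ] F)

theorem unitaryConj_mul (A B : E →L[ℂ] E) :
    unitaryConj V (A * B) = unitaryConj V A * unitaryConj V B :=
  map_mul V.toContinuousLinearEquiv.conjContinuousAlgEquiv A B

theorem unitaryConj_one : unitaryConj V 1 = 1 :=
  map_one V.toContinuousLinearEquiv.conjContinuousAlgEquiv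

theorem unitaryConj_zero : unitaryConj V 0 = 0 :=
  map_zero V.toContinuousLinearEquiv.conjContinuousAlgEquiv

theorem unitaryConj_add (A B : E →L[ℂ] E) :
    unitaryConj V (A + B) = unitaryConj V A + unitaryConj V B :=
  map_add V.toContinuousLinearEquiv.conjContinuousAlgEquiv A B

theorem unitaryConj_smul (c : ℂ) (A : E →L[ℂ] E) :
    unitaryConj V (c • A) = c • unitaryConj V A :=
  map_smul V.toContinuousLinearEquiv.conjContinuousAlgEquiv c A

theorem unitaryConj_bijective : Function.Bijective (unitaryConj V) :=
  V.toContinuousLinearEquiv.conjContinuousAlgEquiv.bijective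

theorem centralizer_image_unitaryConj (S : Set (E →L[ℂ] E)) :
    (unitaryConj V '' S).centralizer = unitaryConj V '' S.centralizer := by
  ext X
  obtain ⟨A, rfl⟩ := (unitaryConj_bijective V).surjective X
  rw [(unitaryConj_bijective V).injective.mem_set_image, Set.mem_centralizer_iff,
    Set.forall_mem_image, Set.mem_centralizer_iff]
  simp only [← unitaryConj_mul, (unitaryConj_bijective V).injective.eq_iff]

variable [CompleteSpace E] [CompleteSpace F]

theorem star_unitaryConj (A : E →L[ℂ] E) : star (unitaryConj V A) = unitaryConj V (star A) := by
  rw [ContinuousLinearMap.star_eq_adjoint, eq_comm, ContinuousLinearMap.eq_adjoint_iff]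
  intro x y
  obtain ⟨x, rfl⟩ := V.surjective x
  obtain ⟨y, rfl⟩ := V.surjective y
  simp [unitaryConj, ContinuousLinearMap.star_eq_adjoint, ContinuousLinearMap.adjoint_inner_left]

theorem isStarProjection_unitaryConj_iff {A : E →L[ℂ] E} :
    IsStarProjection (unitaryConj V A) ↔ IsStarProjection A := by
  rw [isStarProjection_iff, isStarProjection_iff, IsIdempotentElem, IsIdempotentElem,
    IsSelfAdjoint, IsSelfAdjoint, star_unitaryConj, ← unitaryConj_mul,
    (unitaryConj_bijective V).injective.eq_iff, (unitaryConj_bijective V).injective.eq_iff]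

theorem unitaryConj_mem_pencilPairs_iff {T P Q : E →L[ℂ] E} {lam : ℝ} :
    (unitaryConj V P, unitaryConj V Q) ∈ pencilPairs (unitaryConj V T) lam ↔
      (P, Q) ∈ pencilPairs T lam := by
  simp only [pencilPairs, Set.mem_ofPred_eq, isStarProjection_unitaryConj_iff, ← unitaryConj_smul,
    ← unitaryConj_add, (unitaryConj_bijective V).injective.eq_iff]

theorem pencilOps_unitaryConj (T : E →L[ℂ] E) (lam : ℝ) :
    pencilOps (unitaryConj V T) lam = unitaryConj V '' pencilOps T lam := by
  ext X
  constructor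
  · rintro ⟨⟨P, Q⟩, hp, hX⟩
    obtain ⟨P, rfl⟩ := (unitaryConj_bijective V).surjective P
    obtain ⟨Q, rfl⟩ := (unitaryConj_bijective V).surjective Q
    rw [unitaryConj_mem_pencilPairs_iff] at hp
    rcases hX with rfl | rfl
    exacts [⟨P, ⟨_, hp, Or.inl rfl⟩, rfl⟩, ⟨Q, ⟨_, hp, Or.inr rfl⟩, rfl⟩]
  · rintro ⟨_, ⟨p, hp, rfl | rfl⟩, rfl⟩
    exacts [⟨_, (unitaryConj_mem_pencilPairs_iff V).2 hp, Or.inl rfl⟩,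
      ⟨_, (unitaryConj_mem_pencilPairs_iff V).2 hp, Or.inr rfl⟩]

theorem centralizer_pencilOps_unitaryConj {T : E →L[ℂ] E} {lam : ℝ} {S : Set (E →L[ℂ] E)}
    (h : (pencilOps T lam).centralizer = S) :
    (pencilOps (unitaryConj V T) lam).centralizer = unitaryConj V '' S := by
  rw [pencilOps_unitaryConj, centralizer_image_unitaryConj, h]

end Conjugation

/-! ### The generic summand, and the algebra from its commutant -/

section Generic

variable {H : Type*} [NormedAddCommGroup H] [InnerProductSpace ℂ H]
  {K : Type*} [NormedAddCommGroup K] [InnerProductSpace ℂ K] [CompleteSpace K]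

theorem commutant_inflationSummand (T : H →L[ℂ] H) (lam : ℝ)
    (V : TwoFold K ≃ₗᵢ[ℂ] genericSpace T lam) {B : K →L[ℂ] K} (hB : IsSelfAdjoint B) :
    (inflationSummand T lam V B).commutant = commutantSummand T lam V B := by
  refine congrArg (Summand.mk (genericSpace T lam)) ?_
  rw [← centralizer_inflation hB]
  exact centralizer_image_unitaryConj V _

theorem one_mem_inflationSummand_ops (T : H →L[ℂ] H) (lam : ℝ)
    (V : TwoFold K ≃ₗᵢ[ℂ] genericSpace T lam) (B : K →L[ℂ] K) :
    1 ∈ (inflationSummand T lam V B).ops :=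
  ⟨1, ⟨1, one_mem (generatedVNA {B}), opMatrix_one_fin_two.symm⟩, unitaryConj_one V⟩

theorem zero_mem_inflationSummand_ops (T : H →L[ℂ] H) (lam : ℝ)
    (V : TwoFold K ≃ₗᵢ[ℂ] genericSpace T lam) (B : K →L[ℂ] K) :
    0 ∈ (inflationSummand T lam V B).ops := by
  refine ⟨0, ⟨0, zero_mem (generatedVNA {B}), ?_⟩, unitaryConj_zero V⟩
  ext z i
  fin_cases i <;> simp

theorem one_mem_scalarOps_ops (M : Submodule ℂ H) : 1 ∈ (scalarOps M).ops :=
  ⟨1, (one_smul _ _).symm⟩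

theorem zero_mem_scalarOps_ops (M : Submodule ℂ H) : 0 ∈ (scalarOps M).ops :=
  ⟨0, (zero_smul ℂ (1 : M →L[ℂ] M)).symm⟩

variable [CompleteSpace H]

/-- The generic part contributes `W*(B)⁽²⁾` to the commutant. -/
theorem isPencilCommutant_inflationSummand {T : H →L[ℂ] H} (hT : IsSelfAdjoint T) {lam : ℝ}
    (hlam0 : lam ≠ 0) (hlam1 : lam ≠ -1) {B : K →L[ℂ] K} (hB : B.IsPositive)
    (hBlower : StrictOpLT (((abs (1 - |lam|) / 2 : ℝ) : ℂ) • (1 : K →L[ℂ] K)) B)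
    (hBupper : StrictOpLT B ((((1 + |lam|) / 2 : ℝ) : ℂ) • (1 : K →L[ℂ] K)))
    (V : TwoFold K ≃ₗᵢ[ℂ] genericSpace T lam)
    (hV : genericPart T hT lam - (((1 + lam) / 2 : ℝ) : ℂ) • 1 =
      unitaryConj V (opMatrix !![B, 0; 0, -B]))
    [CompleteSpace (inflationSummand T lam V B).space] :
    IsPencilCommutant T lam (inflationSummand T lam V B) := by
  obtain ⟨⟨p, hp⟩, hc⟩ := centralizer_pencilOps_model hlam0 hB hBlower hBupper
  have hT0 : genericPart T hT lam =
      unitaryConj V ((((1 + lam) / 2 : ℝ) : ℂ) • 1 + opMatrix !![B, 0; 0, -B]) := by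
    rw [unitaryConj_add, unitaryConj_smul, unitaryConj_one, ← hV, add_sub_cancel]
  -- An operator preserves `H₀` when its adjoint preserves the null spaces; both relevant classes of
  -- operators are closed under adjoints.
  refine ⟨fun A hA => map_mem_genericSpace_of_star fun c _ x hx => ?_,
    fun A hA => map_mem_genericSpace_of_star fun c hc x hx => ?_,
    genericPart T hT lam, fun x => rfl, ?_, ?_⟩
  · have := hA.star_star
    rw [hT.star_eq] at this
    exact map_mem_nullSpace_of_commute this hx
  · exact map_mem_nullSpace_of_mem_pencilOps hlam0 hlam1 hc (star_mem_pencilOps A hA) hx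
  · rw [hT0]
    exact ⟨_, (unitaryConj_mem_pencilPairs_iff V).2 hp⟩
  · rw [hT0]
    exact (centralizer_pencilOps_unitaryConj V hc).symm

/-- The pencil algebra and its commutant, from a decomposition into pieces whose pencil commutants
are known. -/
theorem coe_pencilVNA_and_commutant {ι : Type*} [Fintype ι] {T : H →L[ℂ] H} {lam : ℝ}
    {s : ι → Summand H} [∀ i, CompleteSpace (s i).space]
    (hs : IsOrthogonalDecomposition fun i => (s i).space)
    (h : ∀ i, IsPencilCommutant T lam (s i)) (h0 : ∀ i, 0 ∈ (s i).ops) (h1 : ∀ i, 1 ∈ (s i).ops) :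
    (pencilVNA T lam : Set (H →L[ℂ] H)) = familyOps (fun i => (s i).commutant) ∧
      ((pencilVNA T lam).commutant : Set (H →L[ℂ] H)) = familyOps s := by
  have hc := centralizer_pencilOps_eq_familyOps hs h
  refine ⟨?_, (coe_commutant_generatedVNA star_mem_pencilOps).trans hc⟩
  refine (coe_generatedVNA (star_mem_pencilOps (T := T) (lam := lam))).trans ?_
  rw [hc, centralizer_familyOps hs h0 h1]

end Generic

/-! ### Assembling the cases `lam = 1` and `lam ≠ 1` -/

section Assembly

variable {H : Type*} [NormedAddCommGroup H] [InnerProductSpace ℂ H]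

theorem familyOps_eq_directSumOps {n : ℕ} (s : Fin n → Summand H) :
    familyOps s = directSumOps (List.ofFn s) := by
  ext A
  simp [familyOps, directSumOps, List.mem_ofFn]

variable [CompleteSpace H]

/-- Null spaces at distinct points of `{0, 1, lam, 1 + lam}`, exhausting this set, form an
orthogonal decomposition together with the generic space. -/
theorem isOrthogonalDecomposition_of_nullSpaces {ι : Type*} {T : H →L[ℂ] H} (hT : IsSelfAdjoint T)
    {lam : ℝ} {M : ι → Submodule ℂ H} (i₀ : ι) (h₀ : M i₀ = genericSpace T lam) (c : ι → ℝ)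
    (hM : ∀ i, i ≠ i₀ → M i = nullSpace T (c i))
    (hmem : ∀ i, i ≠ i₀ → c i = 0 ∨ c i = 1 ∨ c i = lam ∨ c i = 1 + lam)
    (hinj : ∀ i j, i ≠ i₀ → j ≠ i₀ → i ≠ j → c i ≠ c j)
    (hsurj : ∀ d, d = 0 ∨ d = 1 ∨ d = lam ∨ d = 1 + lam → ∃ i, i ≠ i₀ ∧ c i = d) :
    IsOrthogonalDecomposition M := by
  refine ⟨fun i j hij => ?_, fun x hx => ?_⟩
  · dsimp only
    by_cases hi : i = i₀
    · subst hi
      rw [h₀, hM j hij.symm]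
      exact (nullSpace_isOrtho_genericSpace (hmem j hij.symm)).symm
    · by_cases hj : j = i₀
      · subst hj
        rw [h₀, hM i hi]
        exact nullSpace_isOrtho_genericSpace (hmem i hi)
      · rw [hM i hi, hM j hj]
        exact nullSpace_isOrtho hT (hinj i j hi hj hij)
  · have h1 : x ∈ genericSpace T lam := by
      rw [mem_genericSpace_iff]
      intro d hd
      obtain ⟨i, hi, rfl⟩ := hsurj d hd
      rw [← hM i hi]
      exact hx i
    have h2 := hx i₀
    rw [h₀] at h2
    rw [← inner_self_eq_zero (𝕜 := ℂ)]
    exact Submodule.inner_right_of_mem_orthogonal h1 h2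

variable {K : Type*} [NormedAddCommGroup K] [InnerProductSpace ℂ K] [CompleteSpace K]

instance completeSpace_allOps (M : Submodule ℂ H) [h : CompleteSpace M] :
    CompleteSpace (allOps M).space := h

instance completeSpace_scalarOps (M : Submodule ℂ H) [h : CompleteSpace M] :
    CompleteSpace (scalarOps M).space := h

instance completeSpace_inflationSummand (T : H →L[ℂ] H) (lam : ℝ)
    (V : TwoFold K ≃ₗᵢ[ℂ] genericSpace T lam) (B : K →L[ℂ] K) :
    CompleteSpace (inflationSummand T lam V B).space :=
  completeSpace_genericSpace T lam

theorem pencilVNA_of_eq_one {T : H →L[ℂ] H} (hT : IsSelfAdjoint T) {lam : ℝ} {B : K →L[ℂ] K}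
    (hB : B.IsPositive)
    (hBlower : StrictOpLT (((abs (1 - |lam|) / 2 : ℝ) : ℂ) • (1 : K →L[ℂ] K)) B)
    (hBupper : StrictOpLT B ((((1 + |lam|) / 2 : ℝ) : ℂ) • (1 : K →L[ℂ] K)))
    (V : TwoFold K ≃ₗᵢ[ℂ] genericSpace T lam)
    (hV : genericPart T hT lam - (((1 + lam) / 2 : ℝ) : ℂ) • 1 =
      unitaryConj V (opMatrix !![B, 0; 0, -B]))
    (hlam : lam = 1) :
    (pencilVNA T lam : Set (H →L[ℂ] H)) =
        directSumOps [scalarOps (nullSpace T 0), allOps (nullSpace T 1),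
          scalarOps (nullSpace T 2), commutantSummand T lam V B] ∧
      ((pencilVNA T lam).commutant : Set (H →L[ℂ] H)) =
        directSumOps [allOps (nullSpace T 0), scalarOps (nullSpace T 1),
          allOps (nullSpace T 2), inflationSummand T lam V B] := by
  subst hlam
  -- These are the summands of the commutant; those of the algebra arise as their commutants.
  let s : Fin 4 → Summand H := ![allOps (nullSpace T 0), scalarOps (nullSpace T 1),
    allOps (nullSpace T 2), inflationSummand T 1 V B]
  have hcomplete : ∀ i, CompleteSpace (s i).space := by
    simp only [Fin.forall_fin_succ, IsEmpty.forall_iff, and_true]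
    exact ⟨completeSpace_nullSpace T 0, completeSpace_nullSpace T 1, completeSpace_nullSpace T 2,
      completeSpace_genericSpace T 1⟩
  have hs : IsOrthogonalDecomposition fun i => (s i).space := by
    -- For `lam = 1` the points `1` and `lam` coincide, so three null spaces suffice. The last entry
    -- `0` is a dummy value at the index of `H₀`.
    refine isOrthogonalDecomposition_of_nullSpaces hT (lam := 1) 3 rfl ![0, 1, 2, 0] ?_ ?_ ?_ ?_
    · intro i hi
      fin_cases i <;> first | rfl | exact absurd rfl hi
    · intro i hi
      fin_cases i <;> norm_num
    · intro i j hi hj hij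
      fin_cases i <;> fin_cases j <;> simp_all
    · rintro d (rfl | rfl | rfl | rfl)
      exacts [⟨0, by decide, rfl⟩, ⟨1, by decide, rfl⟩, ⟨1, by decide, rfl⟩,
        ⟨2, by decide, show (2 : ℝ) = 1 + 1 by norm_num⟩]
  have hpc : ∀ i, IsPencilCommutant T 1 (s i) := by
    intro i
    fin_cases i
    · exact isPencilCommutant_allOps T one_ne_zero (by norm_num) (e := 0) (f := 0) (by simp)
        (by simp) (by simp) (by simp) (by simp)
    · exact isPencilCommutant_scalarOps T
    · exact isPencilCommutant_allOps T one_ne_zero (by norm_num) (e := 1) (f := 1) (by simp)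
        (by simp) (by simp) (by norm_num) (by norm_num)
    · exact isPencilCommutant_inflationSummand hT one_ne_zero (by norm_num) hB hBlower hBupper V hV
  have h0 : ∀ i, 0 ∈ (s i).ops := by
    intro i
    fin_cases i
    exacts [trivial, zero_mem_scalarOps_ops _, trivial, zero_mem_inflationSummand_ops T 1 V B]
  have h1 : ∀ i, 1 ∈ (s i).ops := by
    intro i
    fin_cases i
    exacts [trivial, one_mem_scalarOps_ops _, trivial, one_mem_inflationSummand_ops T 1 V B]
  obtain ⟨e1, e2⟩ := coe_pencilVNA_and_commutant hs hpc h0 h1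
  rw [familyOps_eq_directSumOps] at e1 e2
  refine ⟨e1.trans ?_, e2⟩
  rw [← commutant_allOps (nullSpace T 0), ← commutant_scalarOps (nullSpace T 1),
    ← commutant_allOps (nullSpace T 2),
    ← commutant_inflationSummand T 1 V hB.isSelfAdjoint]
  rfl

theorem pencilVNA_of_ne_one {T : H →L[ℂ] H} (hT : IsSelfAdjoint T) {lam : ℝ} {B : K →L[ℂ] K}
    (hB : B.IsPositive)
    (hBlower : StrictOpLT (((abs (1 - |lam|) / 2 : ℝ) : ℂ) • (1 : K →L[ℂ] K)) B)
    (hBupper : StrictOpLT B ((((1 + |lam|) / 2 : ℝ) : ℂ) • (1 : K →L[ℂ] K)))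
    (V : TwoFold K ≃ₗᵢ[ℂ] genericSpace T lam)
    (hV : genericPart T hT lam - (((1 + lam) / 2 : ℝ) : ℂ) • 1 =
      unitaryConj V (opMatrix !![B, 0; 0, -B]))
    (hlam0 : lam ≠ 0) (hlam1 : lam ≠ -1) (hlam : lam ≠ 1) :
    (pencilVNA T lam : Set (H →L[ℂ] H)) =
        directSumOps [scalarOps (nullSpace T 0), scalarOps (nullSpace T 1),
          scalarOps (nullSpace T lam), scalarOps (nullSpace T (1 + lam)),
          commutantSummand T lam V B] ∧
      ((pencilVNA T lam).commutant : Set (H →L[ℂ] H)) =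
        directSumOps [allOps (nullSpace T 0), allOps (nullSpace T 1),
          allOps (nullSpace T lam), allOps (nullSpace T (1 + lam)),
          inflationSummand T lam V B] := by
  let s : Fin 5 → Summand H := ![allOps (nullSpace T 0), allOps (nullSpace T 1),
    allOps (nullSpace T lam), allOps (nullSpace T (1 + lam)), inflationSummand T lam V B]
  have hcomplete : ∀ i, CompleteSpace (s i).space := by
    simp only [Fin.forall_fin_succ, IsEmpty.forall_iff, and_true]
    exact ⟨completeSpace_nullSpace T 0, completeSpace_nullSpace T 1, completeSpace_nullSpace T lam,
      completeSpace_nullSpace T (1 + lam), completeSpace_genericSpace T lam⟩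
  have hlam1' : 1 + lam ≠ 0 := fun h => hlam1 (by linarith)
  have hs : IsOrthogonalDecomposition fun i => (s i).space := by
    -- The points `0, 1, lam, 1 + lam` are distinct because `lam ∉ {-1, 0, 1}`; the last entry is
    -- again a dummy.
    refine isOrthogonalDecomposition_of_nullSpaces hT (lam := lam) 4 rfl ![0, 1, lam, 1 + lam, 0]
      ?_ ?_ ?_ ?_
    · intro i hi
      fin_cases i <;> first | rfl | exact absurd rfl hi
    · intro i hi
      fin_cases i <;> simp
    · intro i j hi hj hij
      fin_cases i <;> fin_cases j <;> simp_all [eq_comm]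
    · rintro d (rfl | rfl | rfl | rfl)
      exacts [⟨0, by decide, rfl⟩, ⟨1, by decide, rfl⟩, ⟨2, by decide, rfl⟩,
        ⟨3, by decide, rfl⟩]
  have hpc : ∀ i, IsPencilCommutant T lam (s i) := by
    intro i
    fin_cases i
    · exact isPencilCommutant_allOps T hlam0 hlam1 (e := 0) (f := 0) (by simp)
        (by simp) (by simp) (by simp) (by simp)
    · exact isPencilCommutant_allOps T hlam0 hlam1 (e := 0) (f := 1) (by simp)
        (by simp) (fun h => absurd h hlam) (by simp) (by simp)
    · exact isPencilCommutant_allOps T hlam0 hlam1 (e := 1) (f := 0) (by simp)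
        (by simp) (fun h => absurd h hlam) (by simp) (by simp)
    · exact isPencilCommutant_allOps T hlam0 hlam1 (e := 1) (f := 1) (by simp)
        (by simp) (by simp) (by ring) (by simp)
    · exact isPencilCommutant_inflationSummand hT hlam0 hlam1 hB hBlower hBupper V hV
  have h0 : ∀ i, 0 ∈ (s i).ops := by
    intro i
    fin_cases i
    exacts [trivial, trivial, trivial, trivial, zero_mem_inflationSummand_ops T lam V B]
  have h1 : ∀ i, 1 ∈ (s i).ops := by
    intro i
    fin_cases i
    exacts [trivial, trivial, trivial, trivial, one_mem_inflationSummand_ops T lam V B]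
  obtain ⟨e1, e2⟩ := coe_pencilVNA_and_commutant hs hpc h0 h1
  rw [familyOps_eq_directSumOps] at e1 e2
  refine ⟨e1.trans ?_, e2⟩
  simp only [← commutant_allOps, ← commutant_inflationSummand T lam V hB.isSelfAdjoint]
  rfl

end Assembly

end

theorem theorem2p8
    {H : Type*} [NormedAddCommGroup H] [InnerProductSpace ℂ H] [CompleteSpace H]
    {K : Type*} [NormedAddCommGroup K] [InnerProductSpace ℂ K] [CompleteSpace K]
    (T : H →L[ℂ] H) (hT : IsSelfAdjoint T)
    (lam : ℝ) (hlam0 : lam ≠ 0) (hlam1 : lam ≠ -1)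
    (B : K →L[ℂ] K) (hB : B.IsPositive)
    (hBlower : StrictOpLT (((abs (1 - |lam|) / 2 : ℝ) : ℂ) • (1 : K →L[ℂ] K)) B)
    (hBupper : StrictOpLT B ((((1 + |lam|) / 2 : ℝ) : ℂ) • (1 : K →L[ℂ] K)))
    (V : TwoFold K ≃ₗᵢ[ℂ] genericSpace T lam)
    (hV : genericPart T hT lam - (((1 + lam) / 2 : ℝ) : ℂ) • 1 =
      unitaryConj V (opMatrix !![B, 0; 0, -B])) :
    (lam = 1 →
      (pencilVNA T lam : Set (H →L[ℂ] H)) =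
          directSumOps [scalarOps (nullSpace T 0), allOps (nullSpace T 1),
            scalarOps (nullSpace T 2), commutantSummand T lam V B] ∧
        ((pencilVNA T lam).commutant : Set (H →L[ℂ] H)) =
          directSumOps [allOps (nullSpace T 0), scalarOps (nullSpace T 1),
            allOps (nullSpace T 2), inflationSummand T lam V B]) ∧
    (lam ≠ 1 →
      (pencilVNA T lam : Set (H →L[ℂ] H)) =
          directSumOps [scalarOps (nullSpace T 0), scalarOps (nullSpace T 1),
            scalarOps (nullSpace T lam), scalarOps (nullSpace T (1 + lam)),
            commutantSummand T lam V B] ∧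
        ((pencilVNA T lam).commutant : Set (H →L[ℂ] H)) =
          directSumOps [allOps (nullSpace T 0), allOps (nullSpace T 1),
            allOps (nullSpace T lam), allOps (nullSpace T (1 + lam)),
            inflationSummand T lam V B]) :=
  ⟨pencilVNA_of_eq_one hT hB hBlower hBupper V hV,
    pencilVNA_of_ne_one hT hB hBlower hBupper V hV hlam0 hlam1⟩
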